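/- Let $G$ be a finite graph (loops and multiple edges are allowed, connectedness is not assumed) with $N_G$ edges and $n_G+1$ vertices, where $n_G\ge 3$, and let $q$ be a prime power. Let $\varphi_G=\sum_T\prod_{e\in T}\alpha_e\in\mathbb Z[\{\alpha_e\}_{e\in E(G)}]$ be the dual graph polynomial, the sum running over the spanning trees $T$ of $G$ (so $\varphi_G=0$ if $G$ is disconnected). Attach to each vertex $v$ of $G$ a vector $x_v=(x_v^1,x_v^2,x_v^3,x_v^4)$ of four variables, except that $x_r:=0$ for one chosen vertex $r$. Put $|x|^2:=x^1x^2+x^3x^4$, and let $q_e:=|x_s-x_t|^2$ for an edge $e$ with ends $s,t$; thus $q_e\in\mathbb Z[x_v^j : v\ne r,\ 1\le j\le 4]$. For a polynomial $f$ with integer coefficients in $m$ variables, let $[f]_q$ be the number of points of $\mathbb F_q^m$ at which $f$ vanishes. Define, whenever $q^2$ divides the point count in question, $$c_2^{dual}(G)_q:=[\varphi_G]_q/q^2 \bmod q,\qquad c_2^{pos}(G)_q:=\Big[\prod_{e\in E(G)}q_e\Big]_q\Big/q^2 \bmod q .$$ Then, for every choice of $r$: 1. If $N_G<2n_G$, then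 $q^2$ divides $\big[\prod_e q_e\big]_q$ and $c_2^{pos}(G)_q=0$ in $\mathbb Z/q\mathbb Z$. 2. If $N_G=2n_G$ (that is, $G$ is log-divergent), then $q^2$ divides both $\big[\prod_e q_e\big]_q$ and $[\varphi_G]_q$, and $c_2^{dual}(G)_q=c_2^{pos}(G)_q$ in $\mathbb Z/q\mathbb Z$. -/

import Mathlib

open scoped Graph

noncomputable section

namespace Graph

variable {α β : Type*}

/-- `G` is connected: it has a vertex, and any two vertices are joined by a walk. -/
def IsConnected (G : Graph α β) : Prop :=
  V(G).Nonempty ∧ ∀ x ∈ V(G), ∀ y ∈ V(G), Relation.ReflTransGen G.Adj x y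

/-- `G` has no cycles (loops and pairs of parallel edges being cycles of length one and two):
no edge lies on a cycle, that is, the ends of an edge are never joined by a walk which avoids
that edge. -/
def IsForest (G : Graph α β) : Prop :=
  ∀ ⦃e x y⦄, G.IsLink e x y → ¬ Relation.ReflTransGen (G.deleteEdges {e}).Adj x y

/-- The set `T` of edges of `G`, with all the vertices of `G`, is a spanning tree of `G`. -/
def IsSpanningTree (G : Graph α β) (T : Set β) : Prop :=
  T ⊆ E(G) ∧ (G.restrict T).IsConnected ∧ (G.restrict T).IsForest

/-- `N_G`, the number of edges. -/
def numEdges (G : Graph α β) [Fintype E(G)] : ℕ := Fintype.card E(G)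

/-- `n_G`, the number of vertices minus one. -/
def numVertsPred (G : Graph α β) [Fintype V(G)] : ℕ := Fintype.card V(G) - 1

open Classical in
/-- The dual graph polynomial: the sum over the spanning trees `T` of the product of the
variables of the edges in `T`. -/
def dualPoly (G : Graph α β) [Fintype E(G)] : MvPolynomial E(G) ℤ :=
  ∑ T : Finset E(G) with G.IsSpanningTree (Subtype.val '' (T : Set E(G))),
    ∏ e ∈ T, MvPolynomial.X e

/-- The quadratic form `|x|² = x¹x² + x³x⁴`. -/
def normSq4 {R : Type*} [CommRing R] (x : Fin 4 → R) : R := x 0 * x 1 + x 2 * x 3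

open Classical in
/-- The four coordinates of the vector attached to the vertex `v`: variables, except that the
vector of the root `r` is set to zero. -/
def vertexVec (G : Graph α β) (r v : V(G)) (j : Fin 4) :
    MvPolynomial ({v : V(G) // v ≠ r} × Fin 4) ℤ :=
  if h : v ≠ r then MvPolynomial.X (⟨v, h⟩, j) else 0

lemma exists_ends (G : Graph α β) (e : E(G)) :
    ∃ p : V(G) × V(G), G.IsLink e p.1 p.2 := by
  obtain ⟨x, y, h⟩ := G.exists_isLink_of_mem_edgeSet e.2
  exact ⟨(⟨x, h.left_mem⟩, ⟨y, h.right_mem⟩), h⟩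

/-- The two ends of an edge, in some order. -/
def ends (G : Graph α β) (e : E(G)) : V(G) × V(G) := (G.exists_ends e).choose

/-- The quadric `|x_s - x_t|²` of an edge with ends `s` and `t`; by `quadric_eq` it does not
depend on the order of the ends. -/
def quadric (G : Graph α β) (r : V(G)) (e : E(G)) :
    MvPolynomial ({v : V(G) // v ≠ r} × Fin 4) ℤ :=
  normSq4 fun j => G.vertexVec r (G.ends e).1 j - G.vertexVec r (G.ends e).2 j

lemma quadric_eq (G : Graph α β) (r : V(G)) (e : E(G)) (s t : V(G)) (h : G.IsLink e s t) :
    G.quadric r e = normSq4 fun j => G.vertexVec r s j - G.vertexVec r t j := by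
  have h' : G.IsLink e (G.ends e).1 (G.ends e).2 := (G.exists_ends e).choose_spec
  rcases h'.eq_and_eq_or_eq_and_eq h with ⟨h1, h2⟩ | ⟨h1, h2⟩
  · rw [quadric, Subtype.ext h1, Subtype.ext h2]
  · rw [quadric, Subtype.ext h1, Subtype.ext h2]
    simp only [normSq4]
    ring

/-- The product of the quadrics of all the edges; its zero locus is the union of the quadrics. -/
def posPoly (G : Graph α β) [Fintype E(G)] (r : V(G)) :
    MvPolynomial ({v : V(G) // v ≠ r} × Fin 4) ℤ :=
  ∏ e : E(G), G.quadric r e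

/-- `[f]_q`, the number of points over `K = 𝔽_q` of the affine hypersurface `f = 0`. -/
def pointCount {σ : Type*} (K : Type*) [Field K] (f : MvPolynomial σ ℤ) : ℕ :=
  Nat.card {a : σ → K // MvPolynomial.aeval a f = 0}

/-- The dual `c₂` invariant `[φ_G]_q / q² mod q`. -/
def c2Dual (G : Graph α β) [Fintype E(G)] (K : Type*) [Field K] [Fintype K] :
    ZMod (Fintype.card K) :=
  ((pointCount K G.dualPoly / Fintype.card K ^ 2 : ℕ) : ZMod (Fintype.card K))

/-- The `c₂` invariant in position space, `[∏ q_e]_q / q² mod q`. -/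
def c2Pos (G : Graph α β) [Fintype E(G)] (r : V(G)) (K : Type*) [Field K] [Fintype K] :
    ZMod (Fintype.card K) :=
  ((pointCount K (G.posPoly r) / Fintype.card K ^ 2 : ℕ) : ZMod (Fintype.card K))

end Graph

end

/-!
# The dual and the position space `c₂` invariants

Write `q = |K|`, `n` for the number of vertices other than the root and `N` for the number of
edges. An edge `e` has a coboundary vector `v e` in `Kⁿ`, and edge weights `a` give the weighted
Laplacian `L a = ∑ e, a e • v e (v e)ᵀ`. By the matrix-tree theorem (`Graph.aeval_dualPoly`) the
dual graph polynomial takes the value `det (L a)` at `a`, while the quadric of `e` is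
`⟨v e, x₁⟩ ⟨v e, x₂⟩ + ⟨v e, x₃⟩ ⟨v e, x₄⟩`. The rest is linear algebra over the finite field `K`
for an arbitrary configuration of vectors.

For fixed `x₂` and `x₄` the quadrics form a linear system in `(x₁, x₃)`, whose transpose is the
system `L a x₂ = 0 = L a x₄` in the unknown `a`. Hence the intersection `X` of the quadrics
satisfies `q ^ N * |X| = q ^ (2 * n) * ∑ a, q ^ (2 * corank (L a))` (`pow_mul_quadricsCount`,
`kernelPairCount_eq`). For `N = 2 * n` this makes `|X|` congruent modulo `q ^ 3` to
`c₀ + q ^ 2 * c₁`, where `cₖ` counts the weights of corank `k`, and one has to see that `q ∣ c₁`.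
The analogous sum `∑ a, q ^ corank (L a)` counts pairs `(a, x)` with `L a x = 0`; it is divisible
by `q ^ (N - n)`, since for fixed `x` these are `n` linear equations in the `N` unknowns `a`
(`pow_dvd_kernelVectorCount`). So `q ∣ c₁` follows from `q ^ 2 ∣ c₀`, that is, from the fact that
the number of zeros of `det (L a)` is divisible by `q ^ 2` whenever `N ≥ n + 2`
(`sq_dvd_natCard_det_eq_zero`).

For the latter, assume that the configuration spans and choose coordinates in which it contains the
standard basis. Then `L a` is the sum of a free diagonal matrix and of a symmetric matrix whose
entries are linear forms in at least two further weights. The diagonal entries are eliminated one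
after the other, the determinant being affine linear in each of them
(`sq_dvd_sum_det_eq_zero`). This leads to the common zeros of the determinant and of a principal
minor, which are counted modulo `q` by a second elimination, where the symmetric Desnanot–Jacobi
identity (`Matrix.IsSymm.det_mul_det_submatrix`) turns resultants into squares of minors
(`dvd_sum_det_minor_eq_zero`).

Finally, the union of the quadrics is computed by inclusion–exclusion over the sets of edges
(`Graph.pointCount_posPoly`): the intersection of fewer than `2 * n` quadrics has a number of points
divisible by `q ^ 3` (`cube_dvd_quadricsCount`), and the intersection of `2 * n` quadrics has, up
to sign, as many points modulo `q ^ 3` as `det (L a)` has zeros (`quadricsCount_modEq`).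
-/

/-! ### Determinants and minors -/

namespace Matrix

variable {R : Type*} [CommRing R]

/-- The Desnanot–Jacobi identity. It follows from expanding the `j`-th unit vector, multiplied by
`det P`, as a combination of the rows of `P`. -/
theorem det_mul_det_updateRow_updateRow {ι : Type*} [Fintype ι] [DecidableEq ι]
    (P : Matrix ι ι R) {i j : ι} (hij : i ≠ j) :
    P.det * ((P.updateRow i (Pi.single i 1)).updateRow j (Pi.single j 1)).det =
      P.adjugate i i * P.adjugate j j - P.adjugate i j * P.adjugate j i := by
  set Q := P.updateRow i (Pi.single i 1) with hQ
  have h1 : P.det • (Pi.single j 1 : ι → R) = ∑ k, P.adjugate j k • P k := by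
    have := P.adjugate_mul
    ext l
    have h2 := congrFun (congrFun this j) l
    rw [mul_apply] at h2
    simp only [Pi.smul_apply, smul_eq_mul, Finset.sum_apply, h2, smul_apply, one_apply,
      Pi.single_apply, eq_comm]
  have h2 : ∑ k, P.adjugate j k • P k =
      ∑ k, P.adjugate j k • Q k - P.adjugate j i • (Pi.single i 1 : ι → R)
        + P.adjugate j i • P i := by
    rw [← Finset.add_sum_erase _ _ (Finset.mem_univ i),
      ← Finset.add_sum_erase (a := i) (f := fun k => P.adjugate j k • Q k) _ (Finset.mem_univ i)]
    have : ∑ k ∈ Finset.univ.erase i, P.adjugate j k • Q k =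
        ∑ k ∈ Finset.univ.erase i, P.adjugate j k • P k := by
      refine Finset.sum_congr rfl fun k hk => ?_
      rw [hQ, updateRow_ne (Finset.ne_of_mem_erase hk)]
    rw [this, hQ, updateRow_self]
    abel
  have h3 : (Q.updateRow j (Pi.single i 1)).det = 0 := by
    refine det_zero_of_row_eq hij ?_
    rw [updateRow_self, updateRow_ne hij, hQ, updateRow_self]
  have h4 : (Q.updateRow j (P i)).det = - P.adjugate i j := by
    have h5 := det_permute (Equiv.swap i j) (Q.updateRow j (P i))
    rw [Equiv.Perm.sign_swap hij] at h5
    have h6 : (Q.updateRow j (P i)).submatrix (Equiv.swap i j) id =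
        P.updateRow j (Pi.single i 1) := by
      ext k l
      rcases eq_or_ne k i with rfl | hki
      · simp [updateRow_ne hij]
      rcases eq_or_ne k j with rfl | hkj
      · simp [hQ, updateRow_ne hij]
      · simp [Equiv.swap_apply_of_ne_of_ne hki hkj, updateRow_ne hkj, hQ, updateRow_ne hki]
    rw [h6] at h5
    rw [adjugate_apply, h5]
    simp
  rw [← det_updateRow_smul, h1, h2, det_updateRow_add, sub_eq_add_neg, ← neg_smul,
    det_updateRow_add, det_updateRow_smul, det_updateRow_smul, h3, det_updateRow_sum, h4,
    adjugate_apply P i i, ← hQ]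
  simp only [smul_eq_mul]
  ring

/-- The determinant is affine linear in each diagonal entry. -/
theorem det_add_diagonal_single {ι : Type*} [Fintype ι] [DecidableEq ι]
    (P : Matrix ι ι R) (i : ι) (t : R) :
    (P + diagonal (Pi.single i t)).det = P.det + t * P.adjugate i i := by
  have : P + diagonal (Pi.single i t) = P.updateRow i (P i + t • Pi.single i 1) := by
    ext k l
    rcases eq_or_ne k i with rfl | hki
    · rcases eq_or_ne k l with rfl | hkl
      · simp
      · simp [hkl, hkl.symm]
    · simp [diagonal_apply, hki]
  rw [this, det_updateRow_add, det_updateRow_smul, updateRow_eq_self, adjugate_apply]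

theorem adjugate_last_last {n : ℕ} (P : Matrix (Fin (n + 1)) (Fin (n + 1)) R) :
    P.adjugate (Fin.last n) (Fin.last n) = (P.submatrix Fin.castSucc Fin.castSucc).det := by
  rw [adjugate_fin_succ_eq_det_submatrix]
  simp [Fin.succAbove_last, ← two_mul, pow_mul]

theorem adjugate_zero_zero {n : ℕ} (P : Matrix (Fin (n + 1)) (Fin (n + 1)) R) :
    P.adjugate 0 0 = (P.submatrix Fin.succ Fin.succ).det := by
  rw [adjugate_fin_succ_eq_det_submatrix]
  simp

/-- The Desnanot–Jacobi identity for the first and the last index of a symmetric matrix. -/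
theorem IsSymm.det_mul_det_submatrix {n : ℕ} {P : Matrix (Fin (n + 2)) (Fin (n + 2)) R}
    (hP : P.IsSymm) :
    (P.submatrix Fin.castSucc Fin.castSucc).det * (P.submatrix Fin.succ Fin.succ).det -
      P.det * ((P.submatrix Fin.castSucc Fin.castSucc).submatrix Fin.succ Fin.succ).det =
      P.adjugate 0 (Fin.last (n + 1)) ^ 2 := by
  have h0 : (0 : Fin (n + 2)) ≠ Fin.last (n + 1) := (Fin.last_pos).ne
  have h := det_mul_det_updateRow_updateRow P h0
  have hs : P.adjugate (Fin.last (n + 1)) 0 = P.adjugate 0 (Fin.last (n + 1)) := by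
    have := adjugate_transpose P
    rw [hP.eq] at this
    exact congrFun (congrFun this 0) (Fin.last (n + 1))
  have hm : ((P.updateRow 0 (Pi.single 0 1)).updateRow (Fin.last (n + 1))
      (Pi.single (Fin.last (n + 1)) 1)).det =
      ((P.submatrix Fin.castSucc Fin.castSucc).submatrix Fin.succ Fin.succ).det := by
    rw [← adjugate_apply, adjugate_last_last, ← adjugate_zero_zero, adjugate_apply]
    congr 1
    ext k l
    refine Fin.cases ?_ (fun k => ?_) k
    · simp [Pi.single_apply]
    · rw [submatrix_apply, updateRow_ne (by simp [Fin.castSucc_succ]), updateRow_ne (by simp)]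
      rfl
  rw [hm, adjugate_last_last, adjugate_zero_zero, hs] at h
  rw [h]
  ring

end Matrix

/-! ### Zeros of the determinant of a symmetric matrix with free diagonal -/

section FreeDiagonal

open Matrix

variable {K : Type*}

lemma sum_fin_snoc [Fintype K] {M : Type*} [AddCommMonoid M] {n : ℕ}
    (f : (Fin (n + 1) → K) → M) :
    ∑ d, f d = ∑ d : Fin n → K, ∑ t, f (Fin.snoc d t) := by
  rw [Finset.sum_comm, ← Fintype.sum_prod_type', ← (Fin.snocEquiv fun _ => K).sum_comp]
  rfl

lemma sum_fin_cons [Fintype K] {M : Type*} [AddCommMonoid M] {n : ℕ}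
    (f : (Fin (n + 1) → K) → M) :
    ∑ d, f d = ∑ d : Fin n → K, ∑ t, f (Fin.cons t d) := by
  rw [Finset.sum_comm, ← Fintype.sum_prod_type', ← (Fin.consEquiv fun _ => K).sum_comp]
  rfl

lemma submatrix_castSucc_add_diagonal_snoc [CommRing K] {n : ℕ}
    (P : Matrix (Fin (n + 1)) (Fin (n + 1)) K) (d : Fin n → K) (t : K) :
    (P + diagonal (Fin.snoc d t : Fin (n + 1) → K)).submatrix Fin.castSucc Fin.castSucc =
      P.submatrix Fin.castSucc Fin.castSucc + diagonal d := by
  ext i j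
  simp [diagonal_apply]

lemma submatrix_succ_add_diagonal_cons [CommRing K] {n : ℕ}
    (P : Matrix (Fin (n + 1)) (Fin (n + 1)) K) (d : Fin n → K) (t : K) :
    (P + diagonal (Fin.cons t d : Fin (n + 1) → K)).submatrix Fin.succ Fin.succ =
      P.submatrix Fin.succ Fin.succ + diagonal d := by
  ext i j
  simp [diagonal_apply]

lemma det_add_diagonal_snoc [CommRing K] {n : ℕ} (P : Matrix (Fin (n + 1)) (Fin (n + 1)) K)
    (d : Fin n → K) (t : K) :
    (P + diagonal (Fin.snoc d t : Fin (n + 1) → K)).det =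
      (P + diagonal (Fin.snoc d 0 : Fin (n + 1) → K)).det +
        t * (P.submatrix Fin.castSucc Fin.castSucc + diagonal d).det := by
  have : (Fin.snoc d t : Fin (n + 1) → K) = Fin.snoc d 0 + Pi.single (Fin.last n) t := by
    ext i
    refine Fin.lastCases ?_ (fun i => ?_) i <;> simp
  rw [this, Pi.add_def, ← diagonal_add, ← add_assoc, det_add_diagonal_single, adjugate_last_last,
    submatrix_castSucc_add_diagonal_snoc]

lemma det_add_diagonal_cons [CommRing K] {n : ℕ} (P : Matrix (Fin (n + 1)) (Fin (n + 1)) K)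
    (d : Fin n → K) (t : K) :
    (P + diagonal (Fin.cons t d : Fin (n + 1) → K)).det =
      (P + diagonal (Fin.cons 0 d : Fin (n + 1) → K)).det +
        t * (P.submatrix Fin.succ Fin.succ + diagonal d).det := by
  have : (Fin.cons t d : Fin (n + 1) → K) = Fin.cons 0 d + Pi.single 0 t := by
    ext i
    refine Fin.cases ?_ (fun i => ?_) i <;> simp
  rw [this, Pi.add_def, ← diagonal_add, ← add_assoc, det_add_diagonal_single, adjugate_zero_zero,
    submatrix_succ_add_diagonal_cons]

/-- The minor without the first column and the last row, whose free entries are brought to the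
diagonal by moving the last column to the front. -/
lemma adjugate_zero_last_eq_zero_iff [Field K] {n : ℕ} (P : Matrix (Fin (n + 2)) (Fin (n + 2)) K)
    (d : Fin n → K) :
    (P + diagonal (Fin.cons 0 (Fin.snoc d 0 : Fin (n + 1) → K) : Fin (n + 2) → K)).adjugate 0
        (Fin.last (n + 1)) = 0 ↔
      (P.submatrix Fin.castSucc (Fin.cons (Fin.last (n + 1)) fun k : Fin n => k.castSucc.succ) +
        diagonal (Fin.cons 0 d : Fin (n + 1) → K)).det = 0 := by
  rw [adjugate_fin_succ_eq_det_submatrix]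
  set A := (P + diagonal (Fin.cons 0 (Fin.snoc d 0 : Fin (n + 1) → K) : Fin (n + 2) → K)).submatrix
    (Fin.last (n + 1)).succAbove (Fin.succAbove 0) with hA
  have h : P.submatrix Fin.castSucc
      (Fin.cons (Fin.last (n + 1)) fun k : Fin n => k.castSucc.succ) +
        diagonal (Fin.cons 0 d : Fin (n + 1) → K) = A.submatrix id (finRotate (n + 1)).symm := by
    ext i j
    refine Fin.cases ?_ (fun j => ?_) j
    · have h0 : (finRotate (n + 1)).symm 0 = Fin.last n := by
        rw [Equiv.symm_apply_eq, finRotate_last]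
      rw [submatrix_apply, h0, hA]
      refine Fin.cases ?_ (fun i => ?_) i
      · simp
      · simp [Fin.succ_ne_zero]
    · have h0 : (finRotate (n + 1)).symm j.succ = j.castSucc := by
        rw [Equiv.symm_apply_eq, finRotate_apply, Fin.coeSucc_eq_succ]
      rw [submatrix_apply, h0, hA]
      refine Fin.cases ?_ (fun i => ?_) i
      · simp [(Fin.succ_ne_zero _).symm]
      · simp [diagonal_apply]
  rw [h, ← det_transpose (A.submatrix _ _), transpose_submatrix, det_permute]
  simp [det_transpose]

variable [Field K] [Fintype K] [DecidableEq K]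

/-- The number of zeros of an affine function of one variable. -/
lemma sum_affine_eq_zero (a b : K) :
    (∑ t : K, if b + t * a = 0 then (1 : ℤ) else 0) =
      (if a ≠ 0 then 1 else 0) + Fintype.card K * if b = 0 ∧ a = 0 then 1 else 0 := by
  by_cases ha : a = 0
  · by_cases hb : b = 0 <;> simp [ha, hb]
  · have (t : K) : b + t * a = 0 ↔ t = -b / a := by
      rw [eq_div_iff ha, add_comm, add_eq_zero_iff_eq_neg]
    simp [this, ha]

lemma sum_affine_ne_zero_modEq (a b : K) :
    (∑ t : K, if b + t * a ≠ 0 then (1 : ℤ) else 0) ≡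
      - (if a ≠ 0 then 1 else 0) [ZMOD Fintype.card K] := by
  have h : (∑ t : K, if b + t * a ≠ 0 then (1 : ℤ) else 0) =
      Fintype.card K - ∑ t : K, if b + t * a = 0 then (1 : ℤ) else 0 := by
    rw [eq_sub_iff_add_eq, ← Finset.sum_add_distrib]
    simp only [ite_not, ite_add_ite, zero_add, add_zero, ite_self, Finset.sum_const,
      Finset.card_univ, nsmul_eq_mul, mul_one]
  rw [h, sum_affine_eq_zero, Int.modEq_iff_dvd]
  exact ⟨(if b = 0 ∧ a = 0 then 1 else 0) - 1, by ring⟩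

/-- Two affine equations in one unknown have a common solution only if their resultant `D ^ 2`
vanishes; when both leading coefficients vanish, the number of solutions is `0` modulo `q`. -/
lemma sum_two_affine_eq_zero_modEq {a b c e D : K} (h : a * e - b * c = D ^ 2) :
    (∑ t : K, if b + t * a = 0 ∧ e + t * c = 0 then (1 : ℤ) else 0) ≡
      (if D = 0 then 1 else 0) - (if a = 0 ∧ c = 0 then 1 else 0) [ZMOD Fintype.card K] := by
  have hD : D = 0 ↔ a * e = b * c := by
    rw [← sub_eq_zero (a := a * e), h, pow_eq_zero_iff two_ne_zero]
  simp only [hD]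
  by_cases ha : a = 0
  · by_cases hc : c = 0
    · have : (∑ t : K, if b + t * a = 0 ∧ e + t * c = 0 then (1 : ℤ) else 0) =
          Fintype.card K * if b = 0 ∧ e = 0 then 1 else 0 := by
        simp [ha, hc]
      rw [this]
      refine (Int.modEq_zero_iff_dvd.2 (dvd_mul_right _ _)).trans ?_
      simp [ha, hc, Int.ModEq]
    · have (t : K) : e + t * c = 0 ↔ t = -e / c := by
        rw [eq_div_iff hc, add_comm, add_eq_zero_iff_eq_neg]
      have h2 : (b = 0) ↔ (0 = b ∨ c = 0) := by simp [hc, eq_comm]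
      by_cases hb : b = 0 <;> simp [this, ha, hc, hb, eq_comm, Int.ModEq]
  · have h1 (t : K) : b + t * a = 0 ↔ t = -b / a := by
      rw [eq_div_iff ha, add_comm, add_eq_zero_iff_eq_neg]
    have h2 : e + -b / a * c = 0 ↔ a * e = b * c := by
      rw [← mul_right_inj' ha, mul_zero, ← sub_eq_zero (a := a * e)]
      field_simp
      ring_nf
    have h3 (t : K) : (b + t * a = 0 ∧ e + t * c = 0) ↔ (t = -b / a ∧ a * e = b * c) := by
      rw [h1, ← h2]
      constructor <;> (rintro ⟨rfl, h⟩; exact ⟨rfl, h⟩)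
    simp only [h3]
    by_cases h4 : a * e = b * c <;> simp [h4, ha, Int.ModEq]

/-- If all diagonal entries but the first are free, then the number of invertible matrices is
determined modulo `q` by the first entry, as the determinant is affine linear in each of the
free entries. -/
lemma sum_det_ne_zero_modEq {n : ℕ} (P : Matrix (Fin (n + 1)) (Fin (n + 1)) K) :
    (∑ d : Fin n → K,
      if (P + diagonal (Fin.cons 0 d : Fin (n + 1) → K)).det ≠ 0 then (1 : ℤ) else 0) ≡
      (-1) ^ n * (if P 0 0 ≠ 0 then 1 else 0) [ZMOD Fintype.card K] := by
  induction n with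
  | zero => simp [Int.ModEq]
  | succ n ih =>
    rw [sum_fin_snoc]
    simp only [Fin.cons_snoc_eq_snoc_cons]
    have h (d : Fin n → K) : (∑ t : K, if (P + diagonal
        (Fin.snoc (Fin.cons 0 d : Fin (n + 1) → K) t : Fin (n + 2) → K)).det ≠ 0
          then (1 : ℤ) else 0) ≡ -(if (P.submatrix Fin.castSucc Fin.castSucc +
            diagonal (Fin.cons 0 d : Fin (n + 1) → K)).det ≠ 0 then 1 else 0)
        [ZMOD Fintype.card K] := by
      have e := det_add_diagonal_snoc P (Fin.cons 0 d)
      generalize (P + diagonal (Fin.snoc (Fin.cons 0 d : Fin (n + 1) → K) 0 :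
        Fin (n + 2) → K)).det = b at e
      simp only [e]
      exact sum_affine_ne_zero_modEq _ _
    refine (Int.ModEq.sum fun d _ => h d).trans ?_
    rw [Finset.sum_neg_distrib]
    refine (ih _).neg.trans ?_
    rw [pow_succ, mul_neg_one, neg_mul]
    exact Int.ModEq.rfl

/-- The number of diagonals for which a symmetric matrix and its first principal minor are both
singular, modulo `q`, in terms of the matrix without the last row and column. -/
lemma sum_det_minor_eq_zero_modEq {n : ℕ} {P : Matrix (Fin (n + 2)) (Fin (n + 2)) K}
    (hP : P.IsSymm) :
    (∑ d : Fin (n + 1) → K,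
      if (P + diagonal (Fin.cons 0 d : Fin (n + 2) → K)).det = 0 ∧
        (P.submatrix Fin.succ Fin.succ + diagonal d).det = 0 then (1 : ℤ) else 0) ≡
      (Fintype.card K : ℤ) ^ n - (-1) ^ n * (if P 0 (Fin.last (n + 1)) ≠ 0 then 1 else 0) -
      ∑ d : Fin n → K,
      if (P.submatrix Fin.castSucc Fin.castSucc +
          diagonal (Fin.cons 0 d : Fin (n + 1) → K)).det = 0 ∧
        ((P.submatrix Fin.castSucc Fin.castSucc).submatrix Fin.succ Fin.succ + diagonal d).det = 0
        then (1 : ℤ) else 0 [ZMOD Fintype.card K] := by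
  rw [sum_fin_snoc]
  have h (d : Fin n → K) :
      (∑ t : K, if (P + diagonal
          (Fin.cons 0 (Fin.snoc d t : Fin (n + 1) → K) : Fin (n + 2) → K)).det = 0 ∧
        (P.submatrix Fin.succ Fin.succ + diagonal (Fin.snoc d t : Fin (n + 1) → K)).det = 0
        then (1 : ℤ) else 0) ≡
      (if (P + diagonal (Fin.cons 0 (Fin.snoc d 0 : Fin (n + 1) → K) :
        Fin (n + 2) → K)).adjugate 0 (Fin.last (n + 1)) = 0 then 1 else 0) -
      (if (P.submatrix Fin.castSucc Fin.castSucc +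
          diagonal (Fin.cons 0 d : Fin (n + 1) → K)).det = 0 ∧
        ((P.submatrix Fin.castSucc Fin.castSucc).submatrix Fin.succ Fin.succ + diagonal d).det = 0
        then 1 else 0) [ZMOD Fintype.card K] := by
    have hs : (P + diagonal (Fin.cons 0 (Fin.snoc d 0 : Fin (n + 1) → K) :
        Fin (n + 2) → K)).IsSymm := hP.add (isSymm_diagonal _)
    have h1 := hs.det_mul_det_submatrix
    rw [submatrix_succ_add_diagonal_cons, Fin.cons_snoc_eq_snoc_cons,
      submatrix_castSucc_add_diagonal_snoc, submatrix_succ_add_diagonal_cons,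
      ← Fin.cons_snoc_eq_snoc_cons] at h1
    have h2 := sum_two_affine_eq_zero_modEq h1
    simp only [Fin.cons_snoc_eq_snoc_cons] at h2 ⊢
    have e1 := det_add_diagonal_snoc P (Fin.cons 0 d)
    have e2 := det_add_diagonal_snoc (P.submatrix Fin.succ Fin.succ) d
    generalize (P + diagonal (Fin.snoc (Fin.cons 0 d : Fin (n + 1) → K) 0 :
      Fin (n + 2) → K)).det = b at e1 h2
    generalize (P.submatrix Fin.succ Fin.succ + diagonal (Fin.snoc d 0 :
      Fin (n + 1) → K)).det = b' at e2 h2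
    simp only [e1, e2]
    exact h2
  refine (Int.ModEq.sum fun d _ => h d).trans ?_
  rw [Finset.sum_sub_distrib]
  refine Int.ModEq.sub_right _ ?_
  simp only [adjugate_zero_last_eq_zero_iff]
  set Q := P.submatrix Fin.castSucc
    (Fin.cons (Fin.last (n + 1)) fun k : Fin n => k.castSucc.succ) with hQ
  have h3 : (∑ d : Fin n → K, if (Q + diagonal (Fin.cons 0 d : Fin (n + 1) → K)).det = 0
      then (1 : ℤ) else 0) = (Fintype.card K : ℤ) ^ n - ∑ d : Fin n → K,
        if (Q + diagonal (Fin.cons 0 d : Fin (n + 1) → K)).det ≠ 0 then (1 : ℤ) else 0 := by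
    rw [eq_sub_iff_add_eq, ← Finset.sum_add_distrib]
    simp only [ite_not, ite_add_ite, zero_add, add_zero, ite_self, Finset.sum_const,
      Finset.card_univ, nsmul_eq_mul, mul_one, Fintype.card_fun, Fintype.card_fin, Nat.cast_pow]
  rw [h3]
  exact (sum_det_ne_zero_modEq Q).sub_left _

variable {Ω : Type*} [Fintype Ω]

/-- The recursion `sum_det_minor_eq_zero_modEq` ends with a matrix of size one, for which the minor
is the empty determinant and never vanishes. -/
lemma dvd_sum_det_minor_eq_zero (hΩ : Fintype.card K ∣ Fintype.card Ω) {n : ℕ}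
    (M : Ω → Matrix (Fin (n + 1)) (Fin (n + 1)) K) (hM : ∀ ω, (M ω).IsSymm)
    (h : ∀ i j, i ≠ j → (Fintype.card K : ℤ) ∣ ∑ ω, if M ω i j ≠ 0 then 1 else 0) :
    (Fintype.card K : ℤ) ∣ ∑ ω, ∑ d : Fin n → K,
      if (M ω + diagonal (Fin.cons 0 d : Fin (n + 1) → K)).det = 0 ∧
        ((M ω).submatrix Fin.succ Fin.succ + diagonal d).det = 0 then (1 : ℤ) else 0 := by
  induction n with
  | zero => simp
  | succ n ih =>
    refine (Int.ModEq.dvd_iff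
      (Int.ModEq.sum fun ω _ => sum_det_minor_eq_zero_modEq (hM ω))).2 ?_
    rw [Finset.sum_sub_distrib, Finset.sum_sub_distrib, ← Finset.mul_sum]
    refine ((Dvd.dvd.sub ?_ ?_).sub ?_)
    · rw [Finset.sum_const, Finset.card_univ, nsmul_eq_mul]
      exact (Int.natCast_dvd_natCast.2 hΩ).mul_right _
    · exact (h _ _ Fin.last_pos.ne).mul_left _
    · exact ih _ (fun ω => (hM ω).submatrix _) fun i j hij =>
        h _ _ ((Fin.castSucc_injective _).ne hij)

/-- In a family of symmetric matrices each of whose off-diagonal entries is nonzero for a number of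
parameters divisible by `q`, the number of singular matrices obtained by adding arbitrary diagonals
is divisible by `q ^ 2`: eliminating the first diagonal entry replaces this number by its negative for
the first principal minor, up to `q` times the number counted in `dvd_sum_det_minor_eq_zero`. -/
lemma sq_dvd_sum_det_eq_zero (hΩ : Fintype.card K ^ 2 ∣ Fintype.card Ω) {n : ℕ}
    (M : Ω → Matrix (Fin n) (Fin n) K) (hM : ∀ ω, (M ω).IsSymm)
    (h : ∀ i j, i ≠ j → (Fintype.card K : ℤ) ∣ ∑ ω, if M ω i j ≠ 0 then 1 else 0) :
    (Fintype.card K : ℤ) ^ 2 ∣ ∑ ω, ∑ d : Fin n → K,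
      if (M ω + diagonal d).det = 0 then (1 : ℤ) else 0 := by
  induction n with
  | zero => simp
  | succ n ih =>
    have h1 (ω : Ω) : (∑ d : Fin (n + 1) → K, if (M ω + diagonal d).det = 0 then (1 : ℤ) else 0) =
        (Fintype.card K : ℤ) ^ n - (∑ d : Fin n → K,
          if ((M ω).submatrix Fin.succ Fin.succ + diagonal d).det = 0 then (1 : ℤ) else 0) +
        Fintype.card K * ∑ d : Fin n → K,
          if (M ω + diagonal (Fin.cons 0 d : Fin (n + 1) → K)).det = 0 ∧
            ((M ω).submatrix Fin.succ Fin.succ + diagonal d).det = 0 then (1 : ℤ) else 0 := by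
      have h2 : (∑ d : Fin n → K,
          if ((M ω).submatrix Fin.succ Fin.succ + diagonal d).det ≠ 0 then (1 : ℤ) else 0) =
          (Fintype.card K : ℤ) ^ n - (∑ d : Fin n → K,
          if ((M ω).submatrix Fin.succ Fin.succ + diagonal d).det = 0 then (1 : ℤ) else 0) := by
        rw [eq_sub_iff_add_eq, ← Finset.sum_add_distrib]
        simp only [ite_not, ite_add_ite, zero_add, add_zero, ite_self, Finset.sum_const,
          Finset.card_univ, nsmul_eq_mul, mul_one, Fintype.card_fun, Fintype.card_fin,
          Nat.cast_pow]
      rw [sum_fin_cons, ← h2, Finset.mul_sum, ← Finset.sum_add_distrib]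
      refine Finset.sum_congr rfl fun d _ => ?_
      have e := det_add_diagonal_cons (M ω) d
      generalize (M ω + diagonal (Fin.cons 0 d : Fin (n + 1) → K)).det = b at e ⊢
      simp only [e, sum_affine_eq_zero]
    simp only [h1]
    rw [Finset.sum_add_distrib, Finset.sum_sub_distrib, ← Finset.mul_sum]
    refine (Dvd.dvd.sub ?_ ?_).add ?_
    · rw [Finset.sum_const, Finset.card_univ, nsmul_eq_mul]
      exact (by exact_mod_cast hΩ : (Fintype.card K : ℤ) ^ 2 ∣ Fintype.card Ω).mul_right _
    · exact ih _ (fun ω => (hM ω).submatrix _) fun i j hij =>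
        h _ _ ((Fin.succ_injective _).ne hij)
    · rw [sq]
      exact mul_dvd_mul_left _ (dvd_sum_det_minor_eq_zero
        ((dvd_pow_self _ two_ne_zero).trans hΩ) M hM h)

end FreeDiagonal

/-! ### Weighted Laplacians of vector configurations -/

section VectorConfiguration

open Matrix

lemma natCast_natCard_subtype {X R : Type*} [Fintype X] [AddCommMonoidWithOne R] (p : X → Prop)
    [DecidablePred p] : (Nat.card {x // p x} : R) = ∑ x, if p x then (1 : R) else 0 := by
  rw [Nat.card_eq_fintype_card, Fintype.card_subtype, Finset.sum_boole]

/-- The matrix `∑ e, a e • v e (v e)ᵀ`. If the `v e` are the coboundaries of the edges of a graph,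
this is its reduced Laplacian with edge weights `a`. -/
def weightedLaplacian {E ι R : Type*} [Fintype E] [CommRing R] (v : E → ι → R) (a : E → R) :
    Matrix ι ι R :=
  ∑ e, a e • vecMulVec (v e) (v e)

section CommRing

variable {E F ι R : Type*} [Fintype E] [Fintype F] [CommRing R]

lemma weightedLaplacian_apply (v : E → ι → R) (a : E → R) (i j : ι) :
    weightedLaplacian v a i j = ∑ e, a e * (v e i * v e j) := by
  simp [weightedLaplacian, Matrix.sum_apply, vecMulVec_apply]

lemma weightedLaplacian_isSymm (v : E → ι → R) (a : E → R) : (weightedLaplacian v a).IsSymm := by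
  ext i j
  simp only [transpose_apply, weightedLaplacian_apply, mul_comm (v _ i)]

lemma weightedLaplacian_comp_equiv (σ : F ≃ E) (v : E → ι → R) (a : E → R) :
    weightedLaplacian (v ∘ σ) (a ∘ σ) = weightedLaplacian v a :=
  σ.sum_comp fun e => a e • vecMulVec (v e) (v e)

variable [Fintype ι]

lemma weightedLaplacian_mulVec (v : E → ι → R) (a : E → R) (x : ι → R) :
    weightedLaplacian v a *ᵥ x = ∑ e, (a e * (v e ⬝ᵥ x)) • v e := by
  ext i
  simp only [mulVec, dotProduct, weightedLaplacian_apply, Finset.sum_apply, Pi.smul_apply,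
    smul_eq_mul, Finset.sum_mul, Finset.mul_sum]
  rw [Finset.sum_comm]
  exact Finset.sum_congr rfl fun e _ => Finset.sum_congr rfl fun j _ => by ring

lemma weightedLaplacian_mulVec_comp {κ : Type*} (V : Matrix κ ι R) (w : E → ι → R)
    (a : E → R) :
    weightedLaplacian (fun e => V *ᵥ w e) a = V * weightedLaplacian w a * Vᵀ := by
  simp only [weightedLaplacian, Matrix.mul_sum, Matrix.sum_mul]
  refine Finset.sum_congr rfl fun e _ => ?_
  rw [Matrix.mul_smul, Matrix.smul_mul, mul_vecMulVec, vecMulVec_mul, vecMul_transpose]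

end CommRing

variable {E ι K : Type*} [Fintype E] [Fintype ι] [Field K] [Fintype K]

/-- The solutions of a homogeneous linear system with `k` more unknowns than equations. -/
lemma pow_dvd_natCard_ker {V W : Type*} [AddCommGroup V] [Module K V] [FiniteDimensional K V]
    [AddCommGroup W] [Module K W] [FiniteDimensional K W] (f : V →ₗ[K] W) {k : ℕ}
    (h : Module.finrank K W + k ≤ Module.finrank K V) :
    Fintype.card K ^ k ∣ Nat.card (LinearMap.ker f) := by
  rw [Module.natCard_eq_pow_finrank (K := K), Nat.card_eq_fintype_card]
  refine pow_dvd_pow _ ?_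
  have h1 := f.finrank_range_add_finrank_ker
  have h2 := (LinearMap.range f).finrank_le
  omega

lemma card_dvd_sum_linear_ne_zero [DecidableEq E] [DecidableEq K] (h : 2 ≤ Fintype.card E)
    (c : E → K) :
    (Fintype.card K : ℤ) ∣ ∑ a : E → K, if c ⬝ᵥ a ≠ 0 then 1 else 0 := by
  have h1 : (∑ a : E → K, if c ⬝ᵥ a ≠ 0 then (1 : ℤ) else 0) =
      (Fintype.card K : ℤ) ^ Fintype.card E - ∑ a : E → K, if c ⬝ᵥ a = 0 then (1 : ℤ) else 0 := by
    rw [eq_sub_iff_add_eq, ← Finset.sum_add_distrib]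
    simp only [ite_not, ite_add_ite, zero_add, add_zero, ite_self, Finset.sum_const,
      Finset.card_univ, nsmul_eq_mul, mul_one, Fintype.card_fun, Nat.cast_pow]
  rw [h1]
  refine (dvd_pow_self _ (by omega)).sub ?_
  rw [← natCast_natCard_subtype]
  have h2 := pow_dvd_natCard_ker (K := K) (k := 1) (dotProductBilin K K c)
    (by rw [Module.finrank_self, Module.finrank_fintype_fun_eq_card]; exact h)
  rw [pow_one] at h2
  exact Int.natCast_dvd_natCast.2 h2

/-- The case of a configuration which contains the standard basis, whose weights contribute a free
diagonal. -/
lemma sq_dvd_natCard_det_eq_zero_of_standard {n : ℕ} (h : 2 ≤ Fintype.card E)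
    (w : Fin n ⊕ E → Fin n → K) (hw : ∀ k, w (Sum.inl k) = Pi.single k 1) :
    Fintype.card K ^ 2 ∣ Nat.card {a : Fin n ⊕ E → K // (weightedLaplacian w a).det = 0} := by
  classical
  rw [← Int.natCast_dvd_natCast, natCast_natCard_subtype,
    ← (Equiv.sumArrowEquivProdArrow (Fin n) E K).symm.sum_comp, Fintype.sum_prod_type_right]
  have h1 (d : Fin n → K) (b : E → K) :
      weightedLaplacian w ((Equiv.sumArrowEquivProdArrow (Fin n) E K).symm (d, b)) =
        weightedLaplacian (w ∘ Sum.inr) b + diagonal d := by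
    -- The standard basis vectors contribute `∑ k, d k • e k (e k)ᵀ`.
    rw [weightedLaplacian, Fintype.sum_sum_type, add_comm]
    congr 1
    ext i j
    simp only [Equiv.sumArrowEquivProdArrow_symm_apply_inl, hw, Matrix.sum_apply, Matrix.smul_apply,
      vecMulVec_apply, smul_eq_mul, Pi.single_apply, diagonal_apply]
    by_cases hij : i = j
    · simp [hij]
    · simp only [hij, if_false]
      refine Finset.sum_eq_zero fun k _ => ?_
      by_cases hik : i = k
      · rw [if_neg (fun hjk : j = k => hij (hik.trans hjk.symm)), mul_zero, mul_zero]
      · rw [if_neg hik, zero_mul, mul_zero]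
  simp only [h1]
  rw [Nat.cast_pow]
  refine sq_dvd_sum_det_eq_zero ?_ (fun b => weightedLaplacian (w ∘ Sum.inr) b)
    (weightedLaplacian_isSymm _) fun i j _ => ?_
  · rw [Fintype.card_fun]
    exact pow_dvd_pow _ h
  · have := card_dvd_sum_linear_ne_zero h fun e => w (Sum.inr e) i * w (Sum.inr e) j
    simpa only [weightedLaplacian_apply, dotProduct, Function.comp_apply,
      mul_comm (w _ _ * w _ _)] using this

lemma sq_dvd_natCard_det_eq_zero_fin {n : ℕ} (h : n + 2 ≤ Fintype.card E) (v : E → Fin n → K) :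
    Fintype.card K ^ 2 ∣ Nat.card {a : E → K // (weightedLaplacian v a).det = 0} := by
  classical
  by_cases hv : ∃ a, (weightedLaplacian v a).det ≠ 0
  · -- The vectors span, hence contain a basis, which a change of coordinates makes standard.
    obtain ⟨a, ha⟩ := hv
    have hspan : Submodule.span K (Set.range v) = ⊤ := by
      rw [eq_top_iff]
      rintro y -
      obtain ⟨x, rfl⟩ := mulVec_surjective_iff_isUnit.2
        ((isUnit_iff_isUnit_det _).2 (isUnit_iff_ne_zero.2 ha)) y
      rw [weightedLaplacian_mulVec]
      exact Submodule.sum_mem _ fun e _ =>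
        Submodule.smul_mem _ _ (Submodule.subset_span ⟨e, rfl⟩)
    obtain ⟨κ, f, hf, hs, hli⟩ := exists_linearIndependent' K v
    have : Finite κ := Finite.of_injective f hf
    have := Fintype.ofFinite κ
    rw [hspan] at hs
    have hcard : Fintype.card κ = n := by
      rw [← Module.finrank_eq_card_basis (Module.Basis.mk hli hs.ge)]
      simp
    let g : Fin n ≃ κ := (Fintype.equivFinOfCardEq hcard).symm
    have hfg : Function.Injective (f ∘ g) := hf.comp g.injective
    have hli' : LinearIndependent K (v ∘ f ∘ g) := hli.comp g g.injective
    let V : Matrix (Fin n) (Fin n) K := fun i k => v (f (g k)) i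
    have hV : IsUnit V := linearIndependent_cols_iff_isUnit.1 hli'
    have hVdet : IsUnit V.det := (isUnit_iff_isUnit_det _).1 hV
    let σ : Fin n ⊕ {e // e ∉ Set.range (f ∘ g)} ≃ E :=
      ((Equiv.ofInjective _ hfg).sumCongr (Equiv.refl _)).trans
        (Equiv.sumCompl fun e => e ∈ Set.range (f ∘ g))
    have hσ (k : Fin n) : σ (Sum.inl k) = f (g k) := rfl
    let w : E → Fin n → K := fun e => V⁻¹ *ᵥ v e
    have hvw : v = fun e => V *ᵥ w e := by
      funext e
      rw [mulVec_mulVec, mul_nonsing_inv _ hVdet, one_mulVec]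
    have hdet (a : E → K) :
        (weightedLaplacian v a).det = 0 ↔ (weightedLaplacian (w ∘ σ) (a ∘ σ)).det = 0 := by
      rw [weightedLaplacian_comp_equiv, hvw, weightedLaplacian_mulVec_comp, det_mul, det_mul,
        det_transpose]
      simp [hVdet.ne_zero]
    have hc : Nat.card {a : E → K // (weightedLaplacian v a).det = 0} =
        Nat.card {a : Fin n ⊕ {e // e ∉ Set.range (f ∘ g)} → K //
          (weightedLaplacian (w ∘ σ) a).det = 0} :=
      Nat.card_congr ((σ.symm.arrowCongr (Equiv.refl K)).subtypeEquiv hdet)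
    rw [hc]
    refine sq_dvd_natCard_det_eq_zero_of_standard ?_ _ fun k => ?_
    · have h1 := Fintype.card_congr σ
      rw [Fintype.card_sum, Fintype.card_fin] at h1
      omega
    · have : v (f (g k)) = V *ᵥ Pi.single k 1 := by
        rw [mulVec_single_one]
        rfl
      change V⁻¹ *ᵥ v (σ (Sum.inl k)) = _
      rw [hσ, this, mulVec_mulVec, nonsing_inv_mul _ hVdet, one_mulVec]
  · push Not at hv
    rw [Nat.card_congr (Equiv.subtypeUnivEquiv hv), Nat.card_eq_fintype_card, Fintype.card_fun]
    exact pow_dvd_pow _ (by omega)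

/-- The weights for which the Laplacian of a configuration is singular are divisible by `q ^ 2` in
number, as soon as there are two more vectors than the dimension. -/
theorem sq_dvd_natCard_det_eq_zero [DecidableEq ι] (h : Fintype.card ι + 2 ≤ Fintype.card E)
    (v : E → ι → K) :
    Fintype.card K ^ 2 ∣ Nat.card {a : E → K // (weightedLaplacian v a).det = 0} := by
  let g := Fintype.equivFin ι
  have h1 (a : E → K) : (weightedLaplacian (fun e => v e ∘ g.symm) a).det =
      (weightedLaplacian v a).det := by
    rw [← det_submatrix_equiv_self g.symm (weightedLaplacian v a)]
    congr 1
    ext i j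
    simp [weightedLaplacian_apply]
  simp only [← h1]
  exact sq_dvd_natCard_det_eq_zero_fin h _

end VectorConfiguration

/-! ### Counting kernel vectors of weighted Laplacians -/

section KernelVectors

open Matrix

lemma natCard_subtype_prod {X Y : Type*} [Fintype X] [Finite Y] (p : X → Y → Prop) :
    Nat.card {x : X × Y // p x.1 x.2} = ∑ x, Nat.card {y // p x y} := by
  rw [← Nat.card_sigma]
  exact Nat.card_congr (Equiv.subtypeProdEquivSigmaSubtype p)

lemma natCard_subtype_prod_right {X Y : Type*} [Finite X] [Fintype Y] (p : X → Y → Prop) :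
    Nat.card {x : X × Y // p x.1 x.2} = ∑ y, Nat.card {x // p x y} := by
  rw [← natCard_subtype_prod fun y x => p x y]
  exact Nat.card_congr ((Equiv.prodComm X Y).subtypeEquiv fun _ => Iff.rfl)

variable {E ι K : Type*} [Fintype E] [Fintype ι] [Field K]

/-- The dimension of the kernel of the weighted Laplacian. -/
noncomputable def corank (v : E → ι → K) (a : E → K) : ℕ :=
  Module.finrank K (LinearMap.ker (weightedLaplacian v a).mulVecLin)

lemma corank_eq_zero_iff [DecidableEq ι] (v : E → ι → K) (a : E → K) :
    corank v a = 0 ↔ (weightedLaplacian v a).det ≠ 0 := by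
  rw [corank, Submodule.finrank_eq_zero, LinearMap.ker_eq_bot]
  exact mulVec_injective_iff_isUnit.trans ((isUnit_iff_isUnit_det _).trans isUnit_iff_ne_zero)

variable [Fintype K]

lemma natCard_mulVec_eq_zero_mul_pow_rank {m : Type*} (B : Matrix m ι K) :
    Nat.card {z : ι → K // B *ᵥ z = 0} * Fintype.card K ^ B.rank =
      Fintype.card K ^ Fintype.card ι := by
  have h1 : Nat.card {z : ι → K // B *ᵥ z = 0} = Nat.card (LinearMap.ker B.mulVecLin) := rfl
  rw [h1, Module.natCard_eq_pow_finrank (K := K), Nat.card_eq_fintype_card, ← pow_add,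
    Matrix.rank, add_comm, LinearMap.finrank_range_add_finrank_ker,
    Module.finrank_fintype_fun_eq_card]

/-- A homogeneous linear system and its transpose have, up to normalization, the same number of
solutions. -/
lemma pow_mul_natCard_mulVec_eq_zero (B : Matrix E ι K) :
    Fintype.card K ^ Fintype.card E * Nat.card {z : ι → K // B *ᵥ z = 0} =
      Fintype.card K ^ Fintype.card ι * Nat.card {a : E → K // Bᵀ *ᵥ a = 0} := by
  have h1 := natCard_mulVec_eq_zero_mul_pow_rank B
  have h2 := natCard_mulVec_eq_zero_mul_pow_rank Bᵀ
  rw [rank_transpose] at h2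
  rw [← h1, ← h2]
  ring

/-- The number of weightings together with a kernel vector of the weighted Laplacian. -/
noncomputable def kernelVectorCount (v : E → ι → K) : ℕ :=
  Nat.card {p : (E → K) × (ι → K) // weightedLaplacian v p.1 *ᵥ p.2 = 0}

/-- The number of weightings together with two kernel vectors of the weighted Laplacian. -/
noncomputable def kernelPairCount (v : E → ι → K) : ℕ :=
  Nat.card {p : (E → K) × ((ι → K) × (ι → K)) //
    weightedLaplacian v p.1 *ᵥ p.2.1 = 0 ∧ weightedLaplacian v p.1 *ᵥ p.2.2 = 0}

/-- The number of points in the intersection of the quadrics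
`⟨v e, x₁⟩ ⟨v e, x₂⟩ + ⟨v e, x₃⟩ ⟨v e, x₄⟩ = 0`, a point being written as
`((x₂, x₄), (x₁, x₃))`. -/
noncomputable def quadricsCount (v : E → ι → K) : ℕ :=
  Nat.card {p : ((ι → K) × (ι → K)) × ((ι → K) × (ι → K)) //
    ∀ e, (v e ⬝ᵥ p.2.1) * (v e ⬝ᵥ p.1.1) + (v e ⬝ᵥ p.2.2) * (v e ⬝ᵥ p.1.2) = 0}

/-- For fixed `x₂` and `x₄` the quadrics are linear equations in `(x₁, x₃)`, and the transposed
system says that `x₂` and `x₄` are in the kernel of a weighted Laplacian. -/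
lemma pow_mul_quadricsCount (v : E → ι → K) :
    Fintype.card K ^ Fintype.card E * quadricsCount v =
      Fintype.card K ^ (2 * Fintype.card ι) * kernelPairCount v := by
  classical
  rw [quadricsCount, kernelPairCount,
    natCard_subtype_prod fun y z : (ι → K) × (ι → K) =>
      ∀ e, (v e ⬝ᵥ z.1) * (v e ⬝ᵥ y.1) + (v e ⬝ᵥ z.2) * (v e ⬝ᵥ y.2) = 0,
    natCard_subtype_prod_right fun (a : E → K) (y : (ι → K) × (ι → K)) =>
      weightedLaplacian v a *ᵥ y.1 = 0 ∧ weightedLaplacian v a *ᵥ y.2 = 0,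
    Finset.mul_sum, Finset.mul_sum]
  refine Finset.sum_congr rfl fun y _ => ?_
  let B : Matrix E (ι ⊕ ι) K := fun e =>
    Sum.elim (fun i => (v e ⬝ᵥ y.1) * v e i) (fun i => (v e ⬝ᵥ y.2) * v e i)
  have h := pow_mul_natCard_mulVec_eq_zero B
  have h1 : Nat.card {z : ι ⊕ ι → K // B *ᵥ z = 0} =
      Nat.card {z : (ι → K) × (ι → K) //
        ∀ e, (v e ⬝ᵥ z.1) * (v e ⬝ᵥ y.1) + (v e ⬝ᵥ z.2) * (v e ⬝ᵥ y.2) = 0} := by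
    refine Nat.card_congr ((Equiv.sumArrowEquivProdArrow ι ι K).subtypeEquiv fun z => ?_)
    rw [funext_iff]
    refine forall_congr' fun e => ?_
    rw [mulVec, dotProduct, Fintype.sum_sum_type]
    simp only [B, Sum.elim_inl, Sum.elim_inr, Equiv.sumArrowEquivProdArrow, Equiv.coe_fn_mk,
      Pi.zero_apply, mul_assoc, ← Finset.mul_sum]
    rw [mul_comm (v e ⬝ᵥ y.1), mul_comm (v e ⬝ᵥ y.2)]
    rfl
  have h2 (a : E → K) : Bᵀ *ᵥ a = 0 ↔
      weightedLaplacian v a *ᵥ y.1 = 0 ∧ weightedLaplacian v a *ᵥ y.2 = 0 := by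
    have h3 (i : ι) (x : ι → K) : (weightedLaplacian v a *ᵥ x) i =
        ∑ e, (v e ⬝ᵥ x) * v e i * a e := by
      rw [weightedLaplacian_mulVec, Finset.sum_apply]
      exact Finset.sum_congr rfl fun e _ => by simp only [Pi.smul_apply, smul_eq_mul]; ring
    simp only [funext_iff, Sum.forall, h3, Pi.zero_apply]
    rfl
  rw [h1] at h
  simp only [h2] at h
  rw [h, Fintype.card_sum, two_mul]

lemma pow_dvd_kernelVectorCount (v : E → ι → K) {k : ℕ}
    (h : Fintype.card ι + k ≤ Fintype.card E) :
    Fintype.card K ^ k ∣ kernelVectorCount v := by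
  classical
  rw [kernelVectorCount,
    natCard_subtype_prod_right fun (a : E → K) x => weightedLaplacian v a *ᵥ x = 0]
  refine Finset.dvd_sum fun x _ => ?_
  let f : (E → K) →ₗ[K] (ι → K) := ∑ e, (LinearMap.proj e).smulRight ((v e ⬝ᵥ x) • v e)
  have hf (a : E → K) : f a = weightedLaplacian v a *ᵥ x := by
    rw [weightedLaplacian_mulVec]
    simp [f, mul_smul]
  simp only [← hf]
  exact pow_dvd_natCard_ker f (by simpa using h)

lemma natCard_weightedLaplacian_mulVec_eq_zero (v : E → ι → K) (a : E → K) :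
    Nat.card {x : ι → K // weightedLaplacian v a *ᵥ x = 0} = Fintype.card K ^ corank v a := by
  have h1 : Nat.card {x : ι → K // weightedLaplacian v a *ᵥ x = 0} =
    Nat.card (LinearMap.ker (weightedLaplacian v a).mulVecLin) := rfl
  rw [h1, Module.natCard_eq_pow_finrank (K := K), Nat.card_eq_fintype_card, corank]

variable [DecidableEq E]

lemma kernelVectorCount_eq (v : E → ι → K) :
    kernelVectorCount v = ∑ a, Fintype.card K ^ corank v a := by
  rw [kernelVectorCount,
    natCard_subtype_prod fun (a : E → K) x => weightedLaplacian v a *ᵥ x = 0]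
  simp only [natCard_weightedLaplacian_mulVec_eq_zero]

lemma kernelPairCount_eq (v : E → ι → K) :
    kernelPairCount v = ∑ a, Fintype.card K ^ (2 * corank v a) := by
  rw [kernelPairCount, natCard_subtype_prod fun (a : E → K) (y : (ι → K) × (ι → K)) =>
    weightedLaplacian v a *ᵥ y.1 = 0 ∧ weightedLaplacian v a *ᵥ y.2 = 0]
  refine Finset.sum_congr rfl fun a _ => ?_
  rw [Nat.card_congr (Equiv.subtypeProdEquivProd (p := fun x => weightedLaplacian v a *ᵥ x = 0)
    (q := fun x => weightedLaplacian v a *ᵥ x = 0)), Nat.card_prod,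
    natCard_weightedLaplacian_mulVec_eq_zero, two_mul, pow_add]

lemma kernelVectorCount_modEq (v : E → ι → K) :
    (kernelVectorCount v : ℤ) ≡ (∑ a, if corank v a = 0 then 1 else 0) +
      Fintype.card K * ∑ a, if corank v a = 1 then 1 else 0 [ZMOD Fintype.card K ^ 2] := by
  rw [kernelVectorCount_eq, Nat.cast_sum, Finset.mul_sum, ← Finset.sum_add_distrib]
  refine Int.ModEq.sum fun a _ => ?_
  rcases h : corank v a with _ | _ | c
  · simp [Int.ModEq]
  · simp [Int.ModEq]
  · simp [Int.modEq_zero_iff_dvd, pow_dvd_pow]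

lemma kernelPairCount_modEq (v : E → ι → K) :
    (kernelPairCount v : ℤ) ≡ (∑ a, if corank v a = 0 then 1 else 0) +
      Fintype.card K ^ 2 * ∑ a, if corank v a = 1 then 1 else 0 [ZMOD Fintype.card K ^ 3] := by
  rw [kernelPairCount_eq, Nat.cast_sum, Finset.mul_sum, ← Finset.sum_add_distrib]
  refine Int.ModEq.sum fun a _ => ?_
  rcases h : corank v a with _ | _ | c
  · simp [Int.ModEq]
  · simp [Int.ModEq]
  · have : 3 ≤ 2 * (c + 1 + 1) := by omega
    simp [Int.modEq_zero_iff_dvd, pow_dvd_pow _ this]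

/-- With more vectors than the dimension, the weightings with an invertible Laplacian are divisible
by `q` in number, and the others contribute multiples of `q ^ 2`. -/
lemma card_dvd_kernelPairCount (v : E → ι → K) (h : Fintype.card ι + 1 ≤ Fintype.card E) :
    Fintype.card K ∣ kernelPairCount v := by
  have h1 := pow_dvd_kernelVectorCount v h
  rw [← Int.natCast_dvd_natCast, pow_one] at h1
  have h2 := (kernelVectorCount_modEq v).of_dvd (dvd_pow_self _ two_ne_zero)
  have h3 := (kernelPairCount_modEq v).of_dvd (dvd_pow_self _ three_ne_zero)
  rw [h2.dvd_iff, dvd_add_left (dvd_mul_right _ _)] at h1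
  rw [← Int.natCast_dvd_natCast, h3.dvd_iff,
    dvd_add_left ((dvd_pow_self _ two_ne_zero).mul_right _)]
  exact h1

lemma sum_corank_eq_zero [DecidableEq ι] (v : E → ι → K) :
    (∑ a, if corank v a = 0 then (1 : ℤ) else 0) = (Fintype.card K : ℤ) ^ Fintype.card E -
      Nat.card {a : E → K // (weightedLaplacian v a).det = 0} := by
  classical
  rw [natCast_natCard_subtype, eq_sub_iff_add_eq, ← Finset.sum_add_distrib]
  simp only [corank_eq_zero_iff, ite_not, ite_add_ite, zero_add, add_zero, ite_self,
    Finset.sum_const, Finset.card_univ, nsmul_eq_mul, mul_one, Fintype.card_fun, Nat.cast_pow]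

/-- With at least two more vectors than the dimension, the weightings of corank one are divisible
by `q` in number, so that only the invertible Laplacians contribute to the number of kernel pairs
modulo `q ^ 3`. -/
lemma kernelPairCount_modEq_of_le [DecidableEq ι] (v : E → ι → K)
    (h : Fintype.card ι + 2 ≤ Fintype.card E) :
    (kernelPairCount v : ℤ) ≡ (Fintype.card K : ℤ) ^ Fintype.card E -
      Nat.card {a : E → K // (weightedLaplacian v a).det = 0} [ZMOD Fintype.card K ^ 3] := by
  have h0 : (Fintype.card K : ℤ) ≠ 0 := Nat.cast_ne_zero.2 Fintype.card_ne_zero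
  have h1 := Int.natCast_dvd_natCast.2 (pow_dvd_kernelVectorCount v h)
  have h2 := Int.natCast_dvd_natCast.2 (sq_dvd_natCard_det_eq_zero h v)
  rw [Nat.cast_pow] at h1 h2
  have h3 := sum_corank_eq_zero v
  rw [(kernelVectorCount_modEq v).dvd_iff, h3, dvd_add_right ((pow_dvd_pow _ (by omega)).sub h2),
    sq, mul_dvd_mul_iff_left h0] at h1
  refine (kernelPairCount_modEq v).trans ?_
  rw [h3, Int.modEq_iff_dvd, sub_add_cancel_left, dvd_neg, pow_succ]
  exact mul_dvd_mul_left _ h1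

lemma sq_dvd_kernelPairCount (v : E → ι → K) (h : Fintype.card ι + 2 ≤ Fintype.card E) :
    Fintype.card K ^ 2 ∣ kernelPairCount v := by
  classical
  have h2 := Int.natCast_dvd_natCast.2 (sq_dvd_natCard_det_eq_zero h v)
  have h3 := (kernelPairCount_modEq_of_le v h).of_dvd (pow_dvd_pow _ (by norm_num : 2 ≤ 3))
  rw [← Int.natCast_dvd_natCast]
  rw [Nat.cast_pow] at h2 ⊢
  rw [h3.dvd_iff]
  exact (pow_dvd_pow _ (by omega)).sub h2

/-- Fewer than `2 n` quadrics in dimension `4 n` intersect in a number of points divisible by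
`q ^ 3`. -/
theorem cube_dvd_quadricsCount (v : E → ι → K) (hn : 3 ≤ Fintype.card ι)
    (h : Fintype.card E < 2 * Fintype.card ι) :
    Fintype.card K ^ 3 ∣ quadricsCount v := by
  have h1 := pow_mul_quadricsCount v
  obtain ⟨j, hj⟩ := Nat.exists_eq_add_of_lt h
  rw [hj, add_assoc, pow_add, mul_assoc] at h1
  rw [Nat.eq_of_mul_eq_mul_left (pow_pos Fintype.card_pos _) h1]
  -- The factor `q ^ (j + 1)` is supplemented by the divisibility of the number of kernel pairs.
  match j, hj with
  | 0, hj =>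
    rw [pow_succ', zero_add, pow_one]
    exact mul_dvd_mul_left _ (sq_dvd_kernelPairCount v (by omega))
  | 1, hj =>
    rw [pow_succ]
    exact mul_dvd_mul_left _ (card_dvd_kernelPairCount v (by omega))
  | j + 2, hj => exact (pow_dvd_pow _ (by omega)).mul_right _

/-- The intersection of `2 n` quadrics in dimension `4 n` has, modulo `q ^ 3` and up to sign, as
many points as the determinant of the weighted Laplacian has zeros. -/
theorem quadricsCount_modEq [DecidableEq ι] (v : E → ι → K) (hn : 3 ≤ Fintype.card ι)
    (h : Fintype.card E = 2 * Fintype.card ι) :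
    (quadricsCount v : ℤ) ≡ - Nat.card {a : E → K // (weightedLaplacian v a).det = 0}
      [ZMOD Fintype.card K ^ 3] := by
  have h1 := pow_mul_quadricsCount v
  rw [h] at h1
  rw [Nat.eq_of_mul_eq_mul_left (pow_pos Fintype.card_pos _) h1]
  refine (kernelPairCount_modEq_of_le v (by omega)).trans ?_
  rw [Int.modEq_iff_dvd, neg_sub_left, sub_add_cancel, dvd_neg]
  exact pow_dvd_pow (Fintype.card K : ℤ) (by omega : 3 ≤ Fintype.card E)

end KernelVectors

/-! ### The matrix-tree theorem -/

section CauchyBinet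

open Matrix

variable {E ι R : Type*} [Fintype E] [Fintype ι] [DecidableEq ι] [CommRing R]

/-- Expansion of the determinant along all rows, the `i`-th row being `∑ e, a e * v e i • v e`. -/
lemma det_weightedLaplacian_eq_sum_fun (v : E → ι → R) (a : E → R) :
    (weightedLaplacian v a).det =
      ∑ f : ι → E, (∏ i, a (f i)) * ((∏ i, v (f i) i) * (of fun i => v (f i)).det) := by
  have h1 : weightedLaplacian v a = of fun i => ∑ e, (a e * v e i) • v e := by
    ext i j
    simp [weightedLaplacian_apply, mul_assoc]
  rw [h1]
  refine ((detRowAlternating (n := ι) (R := R)).toMultilinearMap.map_sum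
    fun i e => (a e * v e i) • v e).trans (Finset.sum_congr rfl fun f _ => ?_)
  rw [MultilinearMap.map_smul_univ, Finset.prod_mul_distrib, smul_eq_mul, mul_assoc]
  rfl

variable [DecidableEq E]

/-- The Cauchy–Binet formula for the determinant of a weighted Laplacian. The coefficient of the
squarefree monomial of `T` is obtained by setting the weights equal to one on `T` and to zero
elsewhere. -/
theorem det_weightedLaplacian (v : E → ι → R) (a : E → R) :
    (weightedLaplacian v a).det =
      ∑ T ∈ Finset.powersetCard (Fintype.card ι) Finset.univ,
        (∏ e ∈ T, a e) * (weightedLaplacian v fun e => if e ∈ T then 1 else 0).det := by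
  let c : Finset E → R := fun T => ∑ f : ι → E with Function.Injective f ∧
    Finset.univ.image f = T, (∏ i, v (f i) i) * (of fun i => v (f i)).det
  have h1 (a : E → R) : (weightedLaplacian v a).det =
      ∑ T ∈ Finset.powersetCard (Fintype.card ι) Finset.univ, (∏ e ∈ T, a e) * c T := by
    have h2 : (weightedLaplacian v a).det = ∑ f : ι → E with Function.Injective f,
        (∏ i, a (f i)) * ((∏ i, v (f i) i) * (of fun i => v (f i)).det) := by
      rw [det_weightedLaplacian_eq_sum_fun, Finset.sum_filter_of_ne]
      intro f _ hf
      by_contra hinj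
      rw [Function.Injective] at hinj
      push Not at hinj
      obtain ⟨i, j, hij, hne⟩ := hinj
      refine hf ?_
      have : (of fun i => v (f i)).det = 0 := det_zero_of_row_eq hne (congrArg v hij)
      rw [this, mul_zero, mul_zero]
    rw [h2, ← Finset.sum_fiberwise_of_maps_to (g := fun f => Finset.univ.image f)
      (t := Finset.powersetCard (Fintype.card ι) Finset.univ)]
    · refine Finset.sum_congr rfl fun T _ => ?_
      rw [Finset.filter_filter, Finset.mul_sum]
      refine Finset.sum_congr rfl fun f hf => ?_
      obtain ⟨hinj, rfl⟩ := (Finset.mem_filter.1 hf).2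
      rw [Finset.prod_image fun i _ j _ h => hinj h]
    · intro f hf
      rw [Finset.mem_powersetCard_univ,
        Finset.card_image_of_injective _ (Finset.mem_filter.1 hf).2, Finset.card_univ]
  rw [h1]
  refine Finset.sum_congr rfl fun T hT => ?_
  rw [h1, Finset.sum_eq_single T]
  · rw [Finset.prod_eq_one fun e he => if_pos he, one_mul]
  · intro S hS hST
    have : ¬ S ⊆ T := fun h => hST (Finset.eq_of_subset_of_card_le h (by
      rw [Finset.mem_powersetCard_univ.1 hT, Finset.mem_powersetCard_univ.1 hS]))
    obtain ⟨e, he, heT⟩ := Finset.not_subset.1 this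
    rw [Finset.prod_eq_zero he (if_neg heT), zero_mul]
  · exact fun h => absurd hT h

end CauchyBinet

namespace Graph

open Matrix Relation

variable {α β : Type*} (G : Graph α β)

lemma isLink_ends (e : E(G)) : G.IsLink e (G.ends e).1 (G.ends e).2 :=
  (G.exists_ends e).choose_spec

open Classical in
/-- The indicator function of the vertex `x`, in the coordinates of the vertices other than the
root. -/
noncomputable def vertexIndicator (r : V(G)) (x : α) (i : {v : V(G) // v ≠ r}) : ℤ :=
  if x = i.1.1 then 1 else 0

/-- The coboundary vector of an edge, oriented by `Graph.ends`. -/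
noncomputable def edgeVec (r : V(G)) (e : E(G)) : {v : V(G) // v ≠ r} → ℤ :=
  G.vertexIndicator r (G.ends e).1 - G.vertexIndicator r (G.ends e).2

variable {G} {r : V(G)}

lemma vertexIndicator_root : G.vertexIndicator r r = 0 := by
  funext i
  exact if_neg fun h => i.2 (Subtype.ext h.symm)

lemma vertexIndicator_coe [DecidableEq {v : V(G) // v ≠ r}] (i : {v : V(G) // v ≠ r}) :
    G.vertexIndicator r i.1.1 = Pi.single i 1 := by
  funext j
  classical
  rw [vertexIndicator, Pi.single_apply]
  exact if_congr ⟨fun h => (Subtype.ext (Subtype.ext h)).symm, fun h => by rw [h]⟩ rfl rfl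

lemma vertexIndicator_dotProduct [Fintype {v : V(G) // v ≠ r}] {R : Type*} [CommRing R]
    (x : V(G)) (f : α → R) (hf : f r = 0) :
    (fun i => (G.vertexIndicator r x i : R)) ⬝ᵥ (fun i => f i.1.1) = f x := by
  classical
  by_cases hx : x = r
  · rw [hx, vertexIndicator_root]
    simp [hf]
  · have := vertexIndicator_coe (G := G) (r := r) ⟨x, hx⟩
    simp only at this
    rw [this, dotProduct, Finset.sum_eq_single ⟨x, hx⟩]
    · simp
    · intro j _ hj
      simp [hj]
    · simp

/-- The pairing of an edge vector with a function on the vertices vanishing at the root. -/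
lemma edgeVec_dotProduct [Fintype {v : V(G) // v ≠ r}] {R : Type*} [CommRing R]
    (e : E(G)) (f : α → R) (hf : f r = 0) :
    (fun i => (G.edgeVec r e i : R)) ⬝ᵥ (fun i => f i.1.1) =
      f (G.ends e).1 - f (G.ends e).2 := by
  rw [← vertexIndicator_dotProduct (G.ends e).1 f hf, ← vertexIndicator_dotProduct
    (G.ends e).2 f hf, ← sub_dotProduct]
  congr 1
  funext i
  simp [edgeVec]

lemma vertexIndicator_sub_mem {S : Submodule ℤ ({v : V(G) // v ≠ r} → ℤ)} {e : E(G)}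
    {x y : α} (h : G.IsLink e x y) (he : G.edgeVec r e ∈ S) :
    G.vertexIndicator r y - G.vertexIndicator r x ∈ S := by
  rcases (G.isLink_ends e).eq_and_eq_or_eq_and_eq h with ⟨h1, h2⟩ | ⟨h1, h2⟩
  · rw [← h1, ← h2, ← neg_sub]
    exact S.neg_mem he
  · rw [← h1, ← h2]
    exact he

lemma restrict_image_val_adj {T : Set E(G)} {x y : α} :
    (G.restrict (Subtype.val '' T)).Adj x y ↔ ∃ e ∈ T, G.IsLink e x y := by
  constructor
  · rintro ⟨_, ⟨e, he, rfl⟩, h⟩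
    exact ⟨e, he, h⟩
  · rintro ⟨e, he, h⟩
    exact ⟨e, ⟨e, he, rfl⟩, h⟩

lemma restrict_deleteEdges_adj {T : Set E(G)} {e₀ : E(G)} {x y : α} :
    ((G.restrict (Subtype.val '' T)).deleteEdges {e₀.1}).Adj x y ↔
      ∃ e ∈ T \ {e₀}, G.IsLink e x y := by
  constructor
  · rintro ⟨_, ⟨⟨e, he, rfl⟩, h⟩, hne⟩
    exact ⟨e, ⟨he, fun h' => hne (congrArg Subtype.val h')⟩, h⟩
  · rintro ⟨e, ⟨he, hne⟩, h⟩
    exact ⟨e, ⟨⟨e, he, rfl⟩, h⟩, fun h' => hne (Subtype.ext h')⟩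

lemma vertexIndicator_mem_span {T : Set E(G)} {x : α}
    (h : ReflTransGen (fun x y => ∃ e ∈ T, G.IsLink e x y) r x) :
    G.vertexIndicator r x ∈ Submodule.span ℤ (G.edgeVec r '' T) := by
  induction h with
  | refl => rw [vertexIndicator_root]; exact Submodule.zero_mem _
  | tail _ h ih =>
    obtain ⟨e, he, h⟩ := h
    have := Submodule.add_mem _ ih
      (vertexIndicator_sub_mem h (Submodule.subset_span ⟨e, he, rfl⟩))
    rwa [add_sub_cancel] at this

/-- If the edges of `T` connect the graph, then their vectors generate the lattice: the unit
vector of a vertex is the signed sum of the edges of a walk to the root. -/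
lemma span_edgeVec_eq_top [Finite {v : V(G) // v ≠ r}] {T : Set E(G)}
    (h : ∀ x ∈ V(G), ReflTransGen (fun x y => ∃ e ∈ T, G.IsLink e x y) r x) :
    Submodule.span ℤ (G.edgeVec r '' T) = ⊤ := by
  classical
  have := Fintype.ofFinite {v : V(G) // v ≠ r}
  rw [eq_top_iff, ← (Pi.basisFun ℤ _).span_eq, Submodule.span_le]
  rintro _ ⟨i, rfl⟩
  rw [Pi.basisFun_apply, ← vertexIndicator_coe]
  exact vertexIndicator_mem_span (h _ i.1.2)

/-- A connected graph has at least as many edges as vertices other than the root, since their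
vectors generate the lattice. -/
lemma card_le_of_connected [Fintype {v : V(G) // v ≠ r}] {T : Finset E(G)}
    (h : ∀ x ∈ V(G), ReflTransGen (fun x y => ∃ e ∈ T, G.IsLink e x y) r x) :
    Fintype.card {v : V(G) // v ≠ r} ≤ T.card := by
  classical
  have h1 := span_edgeVec_eq_top (T := (T : Set E(G))) h
  have h2 := finrank_span_finset_le_card (R := ℤ) (T.image (G.edgeVec r))
  rw [Finset.coe_image, Set.finrank, h1, finrank_top, Module.finrank_fintype_fun_eq_card] at h2
  exact h2.trans Finset.card_image_le

lemma reflTransGen_symm {T : Set E(G)} {x y : α}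
    (h : ReflTransGen (fun x y => ∃ e ∈ T, G.IsLink e x y) x y) :
    ReflTransGen (fun x y => ∃ e ∈ T, G.IsLink e x y) y x := by
  induction h with
  | refl => exact ReflTransGen.refl
  | tail _ h ih =>
    obtain ⟨e, he, h⟩ := h
    exact ReflTransGen.head ⟨e, he, h.symm⟩ ih

/-- The edges of a forest are linearly independent: the functional summing over the component of
one end of an edge, after its removal, is dual to this edge. -/
lemma linearIndependent_of_forest [Finite {v : V(G) // v ≠ r}] {T : Finset E(G)}
    (h : (G.restrict (Subtype.val '' (T : Set E(G)))).IsForest) :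
    LinearIndependent ℤ fun e : T => G.edgeVec r e.1 := by
  classical
  have := Fintype.ofFinite {v : V(G) // v ≠ r}
  rw [Fintype.linearIndependent_iff]
  intro g hg e₀
  have hl := G.isLink_ends e₀.1
  set A : α → α → Prop := fun x y => ∃ e ∈ (T : Set E(G)) \ {e₀.1}, G.IsLink e x y with hA
  have hy : ¬ ReflTransGen A (G.ends e₀.1).1 (G.ends e₀.1).2 := by
    have h1 := h (e := e₀.1.1) ⟨⟨e₀.1, e₀.2, rfl⟩, hl⟩
    convert! h1 using 2
    funext x y
    exact propext restrict_deleteEdges_adj.symm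
  let χ : α → ℤ := fun z => if ReflTransGen A (G.ends e₀.1).1 z then 1 else 0
  have hχ (e : T) : (G.edgeVec r e.1) ⬝ᵥ (fun i => χ i.1.1 - χ r) = if e = e₀ then 1 else 0 := by
    have h2 := edgeVec_dotProduct e.1 (fun z => χ z - χ r) (sub_self _)
    simp only [Int.cast_id] at h2
    rw [h2, sub_sub_sub_cancel_right]
    split_ifs with he
    · subst he
      simp only [χ, if_neg hy, if_pos ReflTransGen.refl, sub_zero]
    · have hne : e.1 ≠ e₀.1 := fun h => he (Subtype.ext h)
      have hl' := G.isLink_ends e.1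
      have : ReflTransGen A (G.ends e₀.1).1 (G.ends e.1).1 ↔
          ReflTransGen A (G.ends e₀.1).1 (G.ends e.1).2 :=
        ⟨fun h => h.tail ⟨e.1, ⟨e.2, hne⟩, hl'⟩, fun h => h.tail ⟨e.1, ⟨e.2, hne⟩, hl'.symm⟩⟩
      simp only [χ, this, sub_self]
  have h3 := congrArg (fun u => u ⬝ᵥ (fun i : {v : V(G) // v ≠ r} => χ i.1.1 - χ r)) hg
  simpa only [sum_dotProduct, smul_dotProduct, hχ, zero_dotProduct, smul_eq_mul, mul_ite, mul_one,
    mul_zero, Finset.sum_ite_eq', Finset.mem_univ, if_true] using h3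

lemma isConnected_restrict_iff (r : V(G)) {T : Set E(G)} :
    (G.restrict (Subtype.val '' T)).IsConnected ↔
      ∀ x ∈ V(G), ReflTransGen (fun x y => ∃ e ∈ T, G.IsLink e x y) r x := by
  have h1 : (G.restrict (Subtype.val '' T)).Adj = fun x y => ∃ e ∈ T, G.IsLink e x y := by
    funext x y
    exact propext restrict_image_val_adj
  rw [IsConnected, h1]
  exact ⟨fun h => h.2 r r.2,
    fun h => ⟨⟨r, r.2⟩, fun x hx y hy => (reflTransGen_symm (h x hx)).trans (h y hy)⟩⟩

/-- A spanning tree is the same as a connected spanning subgraph with one edge less than there are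
vertices. -/
lemma isSpanningTree_iff [Fintype {v : V(G) // v ≠ r}] {T : Finset E(G)} :
    G.IsSpanningTree (Subtype.val '' (T : Set E(G))) ↔
      T.card = Fintype.card {v : V(G) // v ≠ r} ∧
        ∀ x ∈ V(G), ReflTransGen (fun x y => ∃ e ∈ T, G.IsLink e x y) r x := by
  classical
  constructor
  · rintro ⟨-, hc, hf⟩
    have hc' := (isConnected_restrict_iff r).1 hc
    refine ⟨le_antisymm ?_ (card_le_of_connected hc'), hc'⟩
    have := (linearIndependent_of_forest (r := r) hf).fintype_card_le_finrank
    simpa using this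
  · rintro ⟨hcard, hc⟩
    refine ⟨?_, (isConnected_restrict_iff r).2 hc, ?_⟩
    · rintro _ ⟨e, -, rfl⟩
      exact e.2
    · rintro _ x y ⟨⟨e₀, he₀, rfl⟩, hl⟩ hxy
      -- An edge on a cycle could be removed, leaving too few edges for a connected graph.
      have h1 : ((G.restrict (Subtype.val '' (T : Set E(G)))).deleteEdges {e₀.1}).Adj =
          fun x y => ∃ e ∈ (T : Set E(G)) \ {e₀}, G.IsLink e x y := by
        funext x y
        exact propext restrict_deleteEdges_adj
      rw [h1] at hxy
      have h2 : ∀ x ∈ V(G),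
          ReflTransGen (fun x y => ∃ e ∈ T.erase e₀, G.IsLink e x y) r x := by
        intro z hz
        have h3 : (fun x y => ∃ e ∈ T.erase e₀, G.IsLink e x y) =
            fun x y => ∃ e ∈ (T : Set E(G)) \ {e₀}, G.IsLink e x y := by
          funext x y
          simp [and_comm]
        rw [h3]
        refine (hc z hz).lift' id fun a b => ?_
        rintro ⟨e, he, hl'⟩
        by_cases hee : e = e₀
        · subst hee
          rcases hl.eq_and_eq_or_eq_and_eq hl' with ⟨rfl, rfl⟩ | ⟨rfl, rfl⟩
          · exact hxy
          · exact reflTransGen_symm hxy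
        · exact ReflTransGen.single ⟨e, ⟨he, hee⟩, hl'⟩
      have h4 := card_le_of_connected h2
      rw [← hcard, Finset.card_erase_of_mem he₀] at h4
      have := Finset.card_pos.2 ⟨e₀, he₀⟩
      omega

variable [Fintype E(G)] [Fintype {v : V(G) // v ≠ r}]

open Classical in
/-- The coefficients in the Cauchy–Binet formula `det_weightedLaplacian` of the graph. -/
lemma det_weightedLaplacian_indicator {T : Finset E(G)}
    (hT : T.card = Fintype.card {v : V(G) // v ≠ r}) :
    (weightedLaplacian (G.edgeVec r) fun e => if e ∈ T then 1 else 0).det =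
      if G.IsSpanningTree (Subtype.val '' (T : Set E(G))) then 1 else 0 := by
  split_ifs with h
  · -- The vectors of the edges form a basis of the lattice, so their Gram determinant is one.
    have hspan := span_edgeVec_eq_top (T := (T : Set E(G))) ((isSpanningTree_iff (r := r)).1 h).2
    let g : {v : V(G) // v ≠ r} ≃ T := Fintype.equivOfCardEq (by simp [hT])
    let A : Matrix {v : V(G) // v ≠ r} {v : V(G) // v ≠ r} ℤ := of fun k => G.edgeVec r (g k)
    have h1 : (weightedLaplacian (G.edgeVec r) fun e => if e ∈ T then 1 else 0) = Aᵀ * A := by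
      ext i j
      simp only [weightedLaplacian_apply, ite_mul, one_mul, zero_mul, mul_apply, transpose_apply]
      rw [← Finset.sum_filter, Finset.filter_mem_eq_inter, Finset.univ_inter,
        ← Finset.sum_coe_sort, ← g.sum_comp]
      rfl
    have h2 (i) : ∃ c : {v : V(G) // v ≠ r} → ℤ,
        ∑ k, c k • G.edgeVec r (g k) = Pi.single i 1 := by
      rw [← Submodule.mem_span_range_iff_exists_fun]
      have : Set.range (fun k => G.edgeVec r (g k)) = G.edgeVec r '' T := by
        ext u
        constructor
        · rintro ⟨k, rfl⟩
          exact ⟨g k, (g k).2, rfl⟩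
        · rintro ⟨e, he, rfl⟩
          exact ⟨g.symm ⟨e, he⟩, by simp⟩
      rw [this, hspan]
      exact Submodule.mem_top
    choose C hC using h2
    have h3 : (of C) * A = 1 := by
      ext i j
      have := congrFun (hC i) j
      rw [Finset.sum_apply] at this
      simpa [A, mul_apply, one_apply, Pi.single_apply, eq_comm] using this
    have h4 : IsUnit A.det := IsUnit.of_mul_eq_one_right _ (by rw [← det_mul, h3, det_one])
    rw [h1, det_mul, det_transpose]
    exact Int.isUnit_mul_self h4
  · rw [isSpanningTree_iff (r := r)] at h
    push Not at h
    obtain ⟨z, hz, hrz⟩ := h hT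
    -- The indicator function of the complement of the component of the root is in the kernel.
    let χ : α → ℤ :=
      fun z => if ReflTransGen (fun x y => ∃ e ∈ T, G.IsLink e x y) r z then 0 else 1
    have hχ : χ r = 0 := if_pos ReflTransGen.refl
    refine exists_mulVec_eq_zero_iff.1 ⟨fun i => χ i.1.1, ?_, ?_⟩
    · intro h0
      have hne : (⟨z, hz⟩ : V(G)) ≠ r := by
        rintro rfl
        exact hrz ReflTransGen.refl
      have := congrFun h0 ⟨⟨z, hz⟩, hne⟩
      exact one_ne_zero ((if_neg hrz).symm.trans this)
    · rw [weightedLaplacian_mulVec]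
      refine Finset.sum_eq_zero fun e _ => ?_
      by_cases he : e ∈ T
      · have h2 := edgeVec_dotProduct e χ hχ
        simp only [Int.cast_id] at h2
        have hl := G.isLink_ends e
        have : ReflTransGen (fun x y => ∃ e ∈ T, G.IsLink e x y) r (G.ends e).1 ↔
            ReflTransGen (fun x y => ∃ e ∈ T, G.IsLink e x y) r (G.ends e).2 :=
          ⟨fun h => h.tail ⟨e, he, hl⟩, fun h => h.tail ⟨e, he, hl.symm⟩⟩
        have h5 : G.edgeVec r e ⬝ᵥ (fun i => χ i.1.1) = 0 := by
          rw [h2]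
          simp only [χ, this, sub_self]
        rw [h5, mul_zero, zero_smul]
      · rw [if_neg he, zero_mul, zero_smul]

open Classical in
/-- The sum defining the dual graph polynomial ranges over the finite sets of edges, coerced to
sets; here it is indexed by the finite sets themselves. -/
lemma dualPoly_eq (G : Graph α β) [Fintype E(G)] :
    G.dualPoly = ∑ T ∈ Finset.univ.filter fun T : Finset E(G) =>
      G.IsSpanningTree (Subtype.val '' (T : Set E(G))), ∏ e ∈ T, MvPolynomial.X e := by
  rw [dualPoly]
  symm
  refine Finset.sum_nbij' (fun T => (T : Set E(G))) (fun T => T.toFinset) ?_ ?_ ?_ ?_ ?_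
  · intro T hT
    simp only [Finset.mem_filter, Finset.mem_univ, true_and] at hT ⊢
    refine ⟨?_, hT⟩
    simp [Finset.bind_def]
  · intro T hT
    simpa using (Finset.mem_filter.1 hT).2
  · simp
  · simp
  · simp

open Classical in
/-- The matrix-tree theorem: the dual graph polynomial is the determinant of the reduced weighted
Laplacian. -/
theorem aeval_dualPoly {R : Type*} [CommRing R] (a : E(G) → R) :
    MvPolynomial.aeval a G.dualPoly =
      (weightedLaplacian (fun e i => (G.edgeVec r e i : R)) a).det := by
  rw [det_weightedLaplacian, dualPoly_eq, map_sum]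
  have h1 (T : Finset E(G)) : (weightedLaplacian (fun e i => (G.edgeVec r e i : R))
      fun e => if e ∈ T then 1 else 0).det =
      ((weightedLaplacian (G.edgeVec r) fun e => if e ∈ T then 1 else 0).det : ℤ) := by
    rw [Int.cast_det]
    congr 1
    ext i j
    simp [weightedLaplacian_apply]
  have h2 : (Finset.univ.filter fun T : Finset E(G) =>
      G.IsSpanningTree (Subtype.val '' (T : Set E(G)))) =
      (Finset.powersetCard (Fintype.card {v : V(G) // v ≠ r}) Finset.univ).filter
        fun T : Finset E(G) =>
        G.IsSpanningTree (Subtype.val '' (T : Set E(G))) := by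
    ext T
    simp only [Finset.mem_filter, Finset.mem_univ, true_and, Finset.mem_powersetCard_univ,
      iff_and_self]
    exact fun h => (isSpanningTree_iff.1 h).1
  rw [h2, Finset.sum_filter]
  refine Finset.sum_congr rfl fun T hT => ?_
  rw [h1, det_weightedLaplacian_indicator (Finset.mem_powersetCard_univ.1 hT)]
  split_ifs <;> simp

end Graph

/-! ### Point counts of the position space and dual graph polynomials -/

namespace Graph

open Matrix

variable {α β : Type*} {G : Graph α β} {r : V(G)}

lemma natCard_normSq4_eq_quadricsCount {E ι K : Type*} [Fintype ι] [Field K] (w : E → ι → K) :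
    Nat.card {x : ι × Fin 4 → K // ∀ e, normSq4 (fun j => w e ⬝ᵥ fun i => x (i, j)) = 0} =
      quadricsCount w :=
  Nat.card_congr <| Equiv.subtypeEquiv
    { toFun := fun x => ((fun i => x (i, 1), fun i => x (i, 3)),
        (fun i => x (i, 0), fun i => x (i, 2)))
      invFun := fun p k => ![p.2.1 k.1, p.1.1 k.1, p.2.2 k.1, p.1.2 k.1] k.2
      left_inv := fun x => by
        funext ⟨i, j⟩
        fin_cases j <;> rfl
      right_inv := fun _ => rfl } fun _ => Iff.rfl

section Quadric

variable {R : Type*} [CommRing R] [Fintype {v : V(G) // v ≠ r}]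

lemma aeval_vertexVec (a : {v : V(G) // v ≠ r} × Fin 4 → R) (v : V(G)) (j : Fin 4) :
    MvPolynomial.aeval a (G.vertexVec r v j) =
      (fun i => (G.vertexIndicator r v i : R)) ⬝ᵥ fun i => a (i, j) := by
  classical
  by_cases hv : v = r
  · rw [vertexVec, dif_neg (not_not.2 hv), hv, vertexIndicator_root]
    simp
  · have := vertexIndicator_coe (G := G) (r := r) ⟨v, hv⟩
    simp only at this
    rw [vertexVec, dif_pos hv, this, dotProduct, Finset.sum_eq_single ⟨v, hv⟩]
    · simp
    · intro j _ hj
      simp [hj]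
    · simp

lemma aeval_quadric (a : {v : V(G) // v ≠ r} × Fin 4 → R) (e : E(G)) :
    MvPolynomial.aeval a (G.quadric r e) =
      normSq4 fun j => (fun i => (G.edgeVec r e i : R)) ⬝ᵥ fun i => a (i, j) := by
  have h (j : Fin 4) : (fun i => (G.edgeVec r e i : R)) ⬝ᵥ (fun i => a (i, j)) =
      MvPolynomial.aeval a (G.vertexVec r (G.ends e).1 j) -
        MvPolynomial.aeval a (G.vertexVec r (G.ends e).2 j) := by
    rw [aeval_vertexVec, aeval_vertexVec, ← sub_dotProduct]
    congr 1
    funext i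
    simp [edgeVec]
  simp only [quadric, normSq4, h, map_add, map_mul, map_sub]

end Quadric

variable [Fintype E(G)] [Fintype {v : V(G) // v ≠ r}] {K : Type*} [Field K] [Fintype K]

/-- Inclusion–exclusion for the union of the quadrics of the edges. -/
lemma pointCount_posPoly :
    (pointCount K (G.posPoly r) : ℤ) =
      (Fintype.card K : ℤ) ^ (Fintype.card {v : V(G) // v ≠ r} * 4) -
        ∑ S : Finset E(G), (-1) ^ S.card *
          (quadricsCount (fun (e : S) i => (G.edgeVec r e.1 i : K)) : ℤ) := by
  classical
  let Q : E(G) → ({v : V(G) // v ≠ r} × Fin 4 → K) → K := fun e a =>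
    normSq4 fun j => (fun i => (G.edgeVec r e i : K)) ⬝ᵥ fun i => a (i, j)
  have h1 (a : {v : V(G) // v ≠ r} × Fin 4 → K) :
      MvPolynomial.aeval a (G.posPoly r) = ∏ e, Q e a := by
    rw [posPoly, map_prod]
    exact Finset.prod_congr rfl fun e _ => aeval_quadric a e
  have h2 (a : {v : V(G) // v ≠ r} × Fin 4 → K) : (if ∏ e, Q e a = 0 then (1 : ℤ) else 0) =
      1 - ∑ S : Finset E(G), (-1) ^ S.card * if ∀ e : S, Q e.1 a = 0 then 1 else 0 := by
    have h3 : (if ∏ e, Q e a = 0 then (1 : ℤ) else 0) =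
        1 - ∏ e, (-(if Q e a = 0 then 1 else 0) + 1) := by
      split_ifs with h
      · obtain ⟨e, he, h0⟩ := Finset.prod_eq_zero_iff.1 h
        rw [Finset.prod_eq_zero he (by simp [h0]), sub_zero]
      · rw [Finset.prod_eq_one fun e he => ?_, sub_self]
        simp [Finset.prod_ne_zero_iff.1 h e he]
    rw [h3, Finset.prod_add_one, Finset.powerset_univ]
    refine congrArg _ (Finset.sum_congr rfl fun S _ => ?_)
    rw [Finset.prod_neg, Finset.prod_ite_zero, Finset.prod_const_one]
    simp only [Subtype.forall]
  rw [pointCount]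
  simp only [h1]
  rw [natCast_natCard_subtype]
  simp only [h2]
  rw [Finset.sum_sub_distrib, Finset.sum_comm]
  congr 1
  · simp
  · refine Finset.sum_congr rfl fun S _ => ?_
    rw [← Finset.mul_sum, ← natCast_natCard_subtype, ← natCard_normSq4_eq_quadricsCount]

/-- With fewer than `2 n` edges, all terms of the inclusion–exclusion formula vanish modulo
`q ^ 3`. -/
lemma cube_dvd_pointCount_posPoly (hn : 3 ≤ Fintype.card {v : V(G) // v ≠ r})
    (h : Fintype.card E(G) < 2 * Fintype.card {v : V(G) // v ≠ r}) :
    Fintype.card K ^ 3 ∣ pointCount K (G.posPoly r) := by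
  rw [← Int.natCast_dvd_natCast, pointCount_posPoly, Nat.cast_pow]
  refine (pow_dvd_pow _ (by omega)).sub (Finset.dvd_sum fun S _ => Dvd.dvd.mul_left ?_ _)
  rw [← Nat.cast_pow]
  classical
  refine Int.natCast_dvd_natCast.2 (cube_dvd_quadricsCount _ hn ?_)
  rw [Fintype.card_coe]
  exact (Finset.card_le_univ S).trans_lt h

/-- With `2 n` edges, only the intersection of all quadrics contributes modulo `q ^ 3`, and it is
counted by the determinant of the Laplacian. -/
lemma pointCount_posPoly_modEq (hn : 3 ≤ Fintype.card {v : V(G) // v ≠ r})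
    (h : Fintype.card E(G) = 2 * Fintype.card {v : V(G) // v ≠ r}) :
    pointCount K (G.posPoly r) ≡ pointCount K G.dualPoly [MOD Fintype.card K ^ 3] := by
  classical
  have hu : (quadricsCount (fun (e : (Finset.univ : Finset E(G))) i =>
      (G.edgeVec r e.1 i : K)) : ℤ) ≡ - pointCount K G.dualPoly [ZMOD Fintype.card K ^ 3] := by
    have h1 : quadricsCount (fun (e : (Finset.univ : Finset E(G))) i =>
        (G.edgeVec r e.1 i : K)) = quadricsCount (fun e i => (G.edgeVec r e i : K)) := by
      rw [← natCard_normSq4_eq_quadricsCount, ← natCard_normSq4_eq_quadricsCount]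
      simp only [Subtype.forall, Finset.mem_univ, true_imp_iff]
    have h2 := quadricsCount_modEq (fun e i => (G.edgeVec r e i : K)) hn h
    simp only [← aeval_dualPoly] at h2
    rw [h1]
    exact h2
  rw [← Int.natCast_modEq_iff, pointCount_posPoly, ← Finset.add_sum_erase _ _ (Finset.mem_univ
    (Finset.univ : Finset E(G))), Finset.card_univ, h,
    (even_two_mul _).neg_one_pow, one_mul, Nat.cast_pow]
  have h3 : (Fintype.card K : ℤ) ^ (Fintype.card {v : V(G) // v ≠ r} * 4) ≡ 0
      [ZMOD Fintype.card K ^ 3] := Int.modEq_zero_iff_dvd.2 (pow_dvd_pow _ (by omega))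
  have h4 : (∑ S ∈ Finset.univ.erase (Finset.univ : Finset E(G)), (-1) ^ S.card *
      (quadricsCount (fun (e : S) i => (G.edgeVec r e.1 i : K)) : ℤ)) ≡ 0
      [ZMOD Fintype.card K ^ 3] := by
    refine Int.modEq_zero_iff_dvd.2 (Finset.dvd_sum fun S hS => Dvd.dvd.mul_left ?_ _)
    rw [← Nat.cast_pow]
    refine Int.natCast_dvd_natCast.2 (cube_dvd_quadricsCount _ hn ?_)
    rw [Fintype.card_coe, ← h]
    exact (Finset.card_lt_iff_ne_univ S).2 (Finset.ne_of_mem_erase hS)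
  simpa using h3.sub (hu.add h4)

end Graph

theorem mainTheorem2 {α β : Type*} (G : Graph α β) [Fintype V(G)] [Fintype E(G)]
    (r : V(G)) (hn : 3 ≤ G.numVertsPred) (K : Type*) [Field K] [Fintype K] :
    (G.numEdges < 2 * G.numVertsPred →
      Fintype.card K ^ 2 ∣ Graph.pointCount K (G.posPoly r) ∧ G.c2Pos r K = 0) ∧
    (G.numEdges = 2 * G.numVertsPred →
      Fintype.card K ^ 2 ∣ Graph.pointCount K (G.posPoly r) ∧
      Fintype.card K ^ 2 ∣ Graph.pointCount K G.dualPoly ∧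
      G.c2Dual K = G.c2Pos r K) := by
  classical
  have hcard : G.numVertsPred = Fintype.card {v : V(G) // v ≠ r} := by
    rw [Graph.numVertsPred, Fintype.card_subtype_compl, Fintype.card_subtype_eq]
  have hq : 0 < Fintype.card K ^ 2 := pow_pos Fintype.card_pos 2
  rw [hcard] at hn ⊢
  refine ⟨fun h => ?_, fun h => ?_⟩
  · have h3 := Graph.cube_dvd_pointCount_posPoly (K := K) hn h
    refine ⟨(pow_dvd_pow _ (by norm_num)).trans h3, ?_⟩
    rw [Graph.c2Pos, ZMod.natCast_eq_zero_iff]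
    exact Nat.dvd_div_of_mul_dvd (by rwa [← pow_succ])
  · have hm := Graph.pointCount_posPoly_modEq (K := K) hn h
    have hd : Fintype.card K ^ 2 ∣ Graph.pointCount K G.dualPoly := by
      simp only [Graph.pointCount, Graph.aeval_dualPoly (r := r)]
      refine sq_dvd_natCard_det_eq_zero ?_ _
      rw [Graph.numEdges] at h
      omega
    have hp : Fintype.card K ^ 2 ∣ Graph.pointCount K (G.posPoly r) :=
      ((hm.of_dvd (pow_dvd_pow _ (by norm_num : 2 ≤ 3))).dvd_iff dvd_rfl).2 hd
    refine ⟨hp, hd, ?_⟩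
    rw [Graph.c2Dual, Graph.c2Pos, ZMod.natCast_eq_natCast_iff]
    refine Nat.ModEq.mul_left_cancel' hq.ne' ?_
    rw [Nat.mul_div_cancel' hp, Nat.mul_div_cancel' hd, ← pow_succ]
    exact hm.symm
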